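/- Let $\Sigma$ be a finite set, let $U=\{u(i,j)\}_{i,j\in\Sigma}$ be a matrix with nonnegative real entries, let $f:\Sigma\to\mathbb R^d$, and let $C\subset\Sigma$ be a nonempty subset such that the block $U_C=\{u(i,j)\}_{i,j\in C}$ is irreducible, i.e. for all $i,j\in C$ there are $n\ge 1$ and a path $i=x_0,x_1,\dots,x_n=j$ in $C$ with $u(x_0,x_1)\cdots u(x_{n-1},x_n)>0$. For $\lambda\in\mathbb R^d$ let $\rho(C,\lambda)$ be the Perron–Frobenius eigenvalue (the spectral radius) of the tilted matrix $\{u(i,j)e^{\langle\lambda,f(j)\rangle}\}_{i,j\in C}$, and put $$I_C(x)=\sup_{\lambda\in\mathbb R^d}\{\langle\lambda,x\rangle-\log\rho(C,\lambda)\}\quad(x\in\mathbb R^d),\qquad Q_C=\{x\in\mathbb R^d: I_C(x)<\infty\}.$$ Let $\|f\|=\max_{s\in\Sigma}\max_{1\le j\le d}|f_j(s)|$ and $K=\{x\in\mathbb R^d:|x_j|\le\|f\|\text{ for all }j\}$. For $x_0\in C$ and $n\ge1$ let $\mu_n$ be the measure on the Borel sets of $\mathbb R^d$ given by $$\mu_n(B)=\sum_{(x_1,\dots,x_n)\in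 C^n:\ \frac1n\sum_{i=1}^n f(x_i)\in B}\ \prod_{i=1}^n u(x_{i-1},x_i).$$ An extended rate function is a lower semicontinuous function $\mathbb R^d\to\mathbb R\cup\{\infty\}$; it is good if its level sets $\{x: I(x)\le a\}$, $a\in\mathbb R$, are compact; a (good) rate function is a (good) extended rate function with values in $[0,\infty]$. Then: 1. $Q_C$ is a nonempty convex compact subset of the cube $K$. 2. $I_C$ is a good extended rate function. If $U_C$ is substochastic (all row sums are at most $1$), then $I_C$ is a good rate function. 3. $I_C$ is convex on $\mathbb R^d$ and strictly convex on the relative interior of $Q_C$. Restricted to $Q_C$, it is uniformly continuous and bounded. 4. For every $x_0\in C$, $\{\mu_n\}$ satisfies the large deviation principle with extended rate function $I_C$: for every Borel set $B\subset\mathbb R^d$, with interior $B^\circ$ and closure $\overline B$, $$-\inf_{x\in B^\circ}I_C(x)\le\liminf_{n\to\infty}\frac1n\log\mu_n(B)\le\limsup_{n\to\infty}\frac1n\log\mu_n(B)\le-\inf_{x\in\overline B}I_C(x),$$ where $\log 0=-\infty$ and $\inf\emptyset=\infty$. -/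

import Mathlib

open MeasureTheory Filter Topology

noncomputable section

namespace NonnegProcess

/-! ### Extended rate functions and the large deviation principle -/

section RateFunctions

variable {E : Type*} [TopologicalSpace E]

/-- An extended rate function: a lower semicontinuous function with values in `ℝ ∪ {∞}`. -/
structure IsExtRateFunction (I : E → EReal) : Prop where
  ne_bot : ∀ x, I x ≠ ⊥
  lsc : LowerSemicontinuous I

/-- A good extended rate function: the level sets `{I ≤ a}`, `a ∈ ℝ`, are moreover compact. -/
structure IsGoodExtRateFunction (I : E → EReal) : Prop extends IsExtRateFunction I where
  isCompact_level : ∀ a : ℝ, IsCompact {x | I x ≤ (a : EReal)}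

/-- A good rate function: a good extended rate function with values in `[0, ∞]`. -/
structure IsGoodRateFunction (I : E → EReal) : Prop extends IsGoodExtRateFunction I where
  nonneg : ∀ x, 0 ≤ I x

/-- The domain of finiteness of an extended real function. -/
def finiteDomain (I : E → EReal) : Set E := {x | I x < ⊤}

/-- The large deviation principle at speed `n` for a sequence of nonnegative measures.
Here `ENNReal.log 0 = ⊥` and the infimum over the empty set is `⊤`. -/
def SatisfiesLDP [MeasurableSpace E] (μ : ℕ → Measure E) (I : E → EReal) : Prop :=
  ∀ B : Set E, MeasurableSet B →
    -(⨅ x ∈ interior B, I x) ≤ liminf (fun n : ℕ => ENNReal.log (μ n B) / (n : EReal)) atTop ∧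
    liminf (fun n : ℕ => ENNReal.log (μ n B) / (n : EReal)) atTop
      ≤ limsup (fun n : ℕ => ENNReal.log (μ n B) / (n : EReal)) atTop ∧
    limsup (fun n : ℕ => ENNReal.log (μ n B) / (n : EReal)) atTop ≤ -(⨅ x ∈ closure B, I x)

/-- Convexity of a function with values in `ℝ ∪ {∞}` (with `0 * ∞ = 0`). -/
def ConvexEReal [AddCommGroup E] [Module ℝ E] (I : E → EReal) : Prop :=
  ∀ x y : E, ∀ a b : ℝ, 0 ≤ a → 0 ≤ b → a + b = 1 →
    I (a • x + b • y) ≤ (a : EReal) * I x + (b : EReal) * I y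

end RateFunctions

/-! ### Nonnegative matrices -/

section Matrices

variable {S : Type*}

/-- The block `U_C` of `U` on the states of `C`. -/
def block (U : Matrix S S ℝ) (C : Finset S) : Matrix C C ℝ :=
  Matrix.of fun i j => U i j

/-- A nonnegative matrix is substochastic if its row sums are at most `1`. -/
def IsSubstochastic {T : Type*} [Fintype T] (A : Matrix T T ℝ) : Prop :=
  (∀ i j, 0 ≤ A i j) ∧ ∀ i, ∑ j, A i j ≤ 1

/-- The tilted matrix `{u(i, j) exp ⟨l, f(j)⟩ : i, j ∈ C}`. -/
def tilted {d : ℕ} (U : Matrix S S ℝ) (C : Finset S) (f : S → Fin d → ℝ) (l : Fin d → ℝ) :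
    Matrix C C ℝ :=
  Matrix.of fun i j => U i j * Real.exp (l ⬝ᵥ f j)

/-- The Perron–Frobenius eigenvalue of an irreducible nonnegative matrix: its dominant eigenvalue,
i.e. its spectral radius, the largest modulus of a complex eigenvalue. -/
def perronEigenvalue {T : Type*} [Fintype T] [DecidableEq T] (A : Matrix T T ℝ) : ℝ :=
  (spectralRadius ℂ (A.map (algebraMap ℝ ℂ))).toReal

/-- The Legendre transform `x ↦ sup_l {⟨l, x⟩ - log ρ(C, l)}` of the logarithm of the
Perron–Frobenius eigenvalue of the tilted matrix. -/
def rate [DecidableEq S] {d : ℕ} (U : Matrix S S ℝ) (C : Finset S) (f : S → Fin d → ℝ)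
    (x : Fin d → ℝ) : EReal :=
  ⨆ l : Fin d → ℝ, ((l ⬝ᵥ x - Real.log (perronEigenvalue (tilted U C f l)) : ℝ) : EReal)

/-- The domain of finiteness `Q_C` of the rate. -/
def rateDomain [DecidableEq S] {d : ℕ} (U : Matrix S S ℝ) (C : Finset S) (f : S → Fin d → ℝ) :
    Set (Fin d → ℝ) :=
  finiteDomain (rate U C f)

/-- The closed cube of width `2‖f‖` about the origin, where `‖f‖ = max_{j, s} |f_j(s)|` is the
(iterated) supremum norm on `S → Fin d → ℝ`. -/
def cube [Fintype S] {d : ℕ} (f : S → Fin d → ℝ) : Set (Fin d → ℝ) :=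
  {x | ∀ j, |x j| ≤ ‖f‖}

end Matrices

/-! ### Nonnegative Markov-like measures -/

section Processes

variable {S : Type*} [Fintype S] [MeasurableSpace S]

/-- The nonnegative path measure up to time `n` built from the matrices `U 1, U 2, …` and the
initial measure `π`: the path `(x 0, …, x n)` has mass `π(x 0) ∏_{i=1}^n u_i(x_{i-1}, x_i)`. -/
def pathMeasure (U : ℕ → Matrix S S ℝ) (π : Measure S) (n : ℕ) : Measure (Fin (n + 1) → S) :=
  ∑ x : Fin (n + 1) → S,
    (π {x 0} * ∏ i : Fin n, ENNReal.ofReal (U ((i : ℕ) + 1) (x i.castSucc) (x i.succ))) •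
      Measure.dirac x

/-- The average `Z_n = (1/n) ∑_{i=1}^n f(X_i)` (the initial state `X_0` is not counted). -/
def average {d : ℕ} (f : S → Fin d → ℝ) (n : ℕ) (x : Fin (n + 1) → S) : Fin d → ℝ :=
  (n : ℝ)⁻¹ • ∑ i : Fin n, f (x i.succ)

/-- The measures `μ_n(B) = 𝕌_{x₀}(Z_n(f) ∈ B, X_1, …, X_n ∈ C)` of the homogeneous nonnegative
process with matrix `U` started from the point mass at `x₀`. -/
def restrictedLaw {d : ℕ} (U : Matrix S S ℝ) (C : Finset S) (f : S → Fin d → ℝ) (x₀ : S)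
    (n : ℕ) : Measure (Fin d → ℝ) :=
  ((pathMeasure (fun _ => U) (Measure.dirac x₀) n).restrict
    {x | ∀ i : Fin n, x i.succ ∈ C}).map (average f n)

end Processes

end NonnegProcess

end

namespace NonnegProcess

/-! ### Perron–Frobenius theory for irreducible nonnegative matrices. -/

section PerronFrobenius

open Matrix Finset

variable {T : Type*} [Fintype T] [DecidableEq T] {A : Matrix T T ℝ}

/-! Write p(l) = log ρ(C, l). The convex-analytic part rests on two facts about p, collected in
`IsPressure`.

First, p stays within a bounded distance M of the support function of a finite set V, the means of f
over cycles (`exists_pressure_bound`). Hence the Legendre transform is at most M on the polytope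
conv V and infinite off it, so Q_C = conv V. On a polytope, a convex lower semicontinuous function
that is bounded above is continuous up to the boundary.

Second, p is convex and has at most one subgradient at each point (`convexOn_pressure`,
`subgradient_pressure_unique`), which plays the role of differentiability: an affine minorant x ↦
l·x - p(l) touches I_C in at most one point. A touching l exists at each point of the relative
interior (`exists_isMax`), whence strict convexity there.

For the large deviations, a positive right eigenvector shows that the exponential moments of μ_n are
e^{n p(l)} up to constant factors (`exists_restrictedLaw_moment_bounds`). Chebyshev's inequality and
compactness give the upper bound. For the lower bound, tilting by an l that exposes x makes the mass
concentrate near x; boundary points of the polytope are reached along segments, by convexity of I_C.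
-/

lemma exists_sum_pow_pos (hA : A.IsIrreducible) :
    ∃ N : ℕ, ∀ i j, 0 < (∑ k ∈ range N, A ^ k) i j := by
  have h := (isIrreducible_iff_exists_pow_pos hA.nonneg).1 hA
  choose k _ hk using h
  refine ⟨(univ.sup fun i => univ.sup fun j => k i j) + 1, fun i j => ?_⟩
  rw [Matrix.sum_apply]
  refine sum_pos' (fun l _ => pow_apply_nonneg hA.nonneg l i j) ⟨k i j, ?_, hk i j⟩
  rw [mem_range, Nat.lt_succ_iff]
  exact (le_sup (f := fun j => k i j) (mem_univ j)).trans
    (le_sup (f := fun i => univ.sup fun j => k i j) (mem_univ i))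

omit [DecidableEq T] in
lemma mulVec_pos_of_pos {B : Matrix T T ℝ} (hB : ∀ i j, 0 < B i j) {x : T → ℝ}
    (hx : ∀ i, 0 ≤ x i) {j : T} (hj : 0 < x j) (i : T) : 0 < (B *ᵥ x) i := by
  rw [mulVec_apply_eq_sum]
  exact sum_pos' (fun l _ => mul_nonneg (hB i l).le (hx l)) ⟨j, mem_univ j, mul_pos (hB i j) hj⟩

lemma pow_mulVec_eq {r : ℝ} {x : T → ℝ} (h : A *ᵥ x = r • x) (k : ℕ) :
    (A ^ k) *ᵥ x = r ^ k • x := by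
  induction k with
  | zero => simp
  | succ k ih => rw [pow_succ, ← mulVec_mulVec, h, mulVec_smul, ih, smul_smul, pow_succ, mul_comm]

lemma sum_pow_mulVec_eq {r : ℝ} {x : T → ℝ} (h : A *ᵥ x = r • x) (N : ℕ) :
    (∑ k ∈ range N, A ^ k) *ᵥ x = (∑ k ∈ range N, r ^ k) • x := by
  rw [sum_mulVec, sum_smul]
  exact sum_congr rfl fun k _ => pow_mulVec_eq h k

/-- A nonnegative nonzero eigenvector of an irreducible matrix is positive. -/
lemma pos_of_eigenvector (hA : A.IsIrreducible) {r : ℝ} (hr : 0 ≤ r) {x : T → ℝ}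
    (hx : ∀ i, 0 ≤ x i) {j : T} (hj : 0 < x j) (h : A *ᵥ x = r • x) (i : T) : 0 < x i := by
  obtain ⟨N, hN⟩ := exists_sum_pow_pos hA
  have h1 := mulVec_pos_of_pos hN hx hj i
  rw [sum_pow_mulVec_eq h, Pi.smul_apply, smul_eq_mul] at h1
  exact pos_of_mul_pos_right h1 (sum_nonneg fun k _ => pow_nonneg hr k)

/-- Collatz–Wielandt: take the largest r with r x ≤ A x for some x in the simplex. Were the
inequality strict in one coordinate, the positive matrix B, which commutes with A, would make it
strict in all of them, and r could be raised. -/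
lemma exists_pos_eigenvector [Nonempty T] (hA : A.IsIrreducible) :
    ∃ r : ℝ, 0 < r ∧ ∃ h : T → ℝ, (∀ i, 0 < h i) ∧ A *ᵥ h = r • h := by
  obtain ⟨N, hN⟩ := exists_sum_pow_pos hA
  set B := ∑ k ∈ range N, A ^ k with hB
  set R : ℝ := ∑ i, ∑ j, A i j with hR
  have hbound : ∀ x ∈ stdSimplex ℝ T, ∀ r : ℝ, (∀ i, r * x i ≤ (A *ᵥ x) i) → r ≤ R := by
    intro x hx r hr
    calc r = ∑ i, r * x i := by rw [← mul_sum, hx.2, mul_one]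
      _ ≤ ∑ i, (A *ᵥ x) i := sum_le_sum fun i _ => hr i
      _ ≤ R := by
        refine sum_le_sum fun i _ => ?_
        rw [mulVec_apply_eq_sum]
        refine sum_le_sum fun j _ => mul_le_of_le_one_right (hA.nonneg i j) ?_
        exact (single_le_sum (f := x) (fun k _ => hx.1 k) (mem_univ j)).trans hx.2.le
  set D : Set ((T → ℝ) × ℝ) :=
    (stdSimplex ℝ T ×ˢ Set.Icc 0 R) ∩ {p | ∀ i, p.2 * p.1 i ≤ (A *ᵥ p.1) i} with hD
  have hDc : IsCompact D := by
    refine ((isCompact_stdSimplex ℝ T).prod isCompact_Icc).inter_right ?_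
    simp only [Set.ofPred_forall]
    refine isClosed_iInter fun i => isClosed_le (by fun_prop) ?_
    simp only [mulVec_apply_eq_sum]
    fun_prop
  have hR0 : 0 ≤ R := sum_nonneg fun i _ => sum_nonneg fun j _ => hA.nonneg i j
  have hDn : D.Nonempty := by
    obtain ⟨i₀⟩ := ‹Nonempty T›
    refine ⟨(Pi.single i₀ 1, 0), ⟨single_mem_stdSimplex ℝ i₀, le_rfl, hR0⟩, fun i => ?_⟩
    simp only [zero_mul]
    rw [mulVec_apply_eq_sum]
    refine sum_nonneg fun j _ => mul_nonneg (hA.nonneg i j) ?_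
    exact (single_mem_stdSimplex ℝ i₀).1 j
  obtain ⟨⟨x, r⟩, ⟨⟨hx, hr⟩, hxr⟩, hmax⟩ := hDc.exists_isMaxOn hDn continuous_snd.continuousOn
  simp only at hx hr hxr
  obtain ⟨j, hj⟩ : ∃ j, 0 < x j := by
    by_contra! hcon
    have := sum_nonpos fun i (_ : i ∈ univ) => hcon i
    rw [hx.2] at this
    linarith
  have heq : A *ᵥ x = r • x := by
    by_contra hne
    obtain ⟨i₁, hi₁⟩ : ∃ i, r * x i < (A *ᵥ x) i := by
      by_contra! hcon
      exact hne (funext fun i => le_antisymm (hcon i) (hxr i))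
    set y := B *ᵥ x with hy
    have hy0 : ∀ i, 0 < y i := mulVec_pos_of_pos hN hx.1 hj
    have hcomm : A * B = B * A := by
      rw [hB, mul_sum, sum_mul]
      exact sum_congr rfl fun k _ => (pow_mul_comm' A k).symm
    have hAy : ∀ i, 0 < (A *ᵥ y - r • y) i := by
      have : A *ᵥ y - r • y = B *ᵥ (A *ᵥ x - r • x) := by
        rw [hy, mulVec_mulVec, hcomm, mulVec_sub, mulVec_mulVec, mulVec_smul]
      rw [this]
      exact mulVec_pos_of_pos hN (fun i => sub_nonneg.2 (hxr i)) (j := i₁) (sub_pos.2 hi₁)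
    obtain ⟨i₂, hi₂⟩ := Finite.exists_min fun i => (A *ᵥ y - r • y) i / y i
    set ε := (A *ᵥ y - r • y) i₂ / y i₂ with hε
    have hε0 : 0 < ε := div_pos (hAy i₂) (hy0 i₂)
    set s := ∑ i, y i with hs
    have hs0 : 0 < s := sum_pos (fun i _ => hy0 i) univ_nonempty
    have hz : s⁻¹ • y ∈ stdSimplex ℝ T := by
      refine ⟨fun i => mul_nonneg (inv_nonneg.2 hs0.le) (hy0 i).le, ?_⟩
      simp only [Pi.smul_apply, smul_eq_mul]
      rw [← mul_sum, inv_mul_cancel₀ hs0.ne']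
    have hzr : ∀ i, (r + ε) * (s⁻¹ • y) i ≤ (A *ᵥ (s⁻¹ • y)) i := by
      intro i
      have h1 := (le_div_iff₀ (hy0 i)).1 (hi₂ i)
      simp only [Pi.sub_apply, Pi.smul_apply, smul_eq_mul] at h1
      rw [mulVec_smul]
      simp only [Pi.smul_apply, smul_eq_mul]
      rw [mul_left_comm]
      refine mul_le_mul_of_nonneg_left ?_ (inv_nonneg.2 hs0.le)
      rw [add_mul]
      linarith
    have hmem : (s⁻¹ • y, r + ε) ∈ D :=
      ⟨⟨hz, by have := hr.1; simp only; linarith, hbound _ hz _ hzr⟩, hzr⟩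
    have := hmax hmem
    simp only [Set.mem_ofPred_eq] at this
    linarith
  have hpos := pos_of_eigenvector hA hr.1 hx.1 hj heq
  refine ⟨r, hr.1.lt_of_ne' fun h0 => ?_, x, hpos, heq⟩
  -- If r = 0, every positive power of A kills x, yet some power has a positive diagonal entry.
  subst h0
  obtain ⟨k, hk, hk'⟩ := (isIrreducible_iff_exists_pow_pos hA.nonneg).1 hA j j
  have h1 := congrFun (pow_mulVec_eq heq k) j
  rw [zero_pow hk.ne', zero_smul, mulVec_apply_eq_sum] at h1
  have h2 := single_le_sum (f := fun l => (A ^ k) j l * x l)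
    (fun l _ => mul_nonneg (pow_apply_nonneg hA.nonneg k j l) (hx.1 l)) (mem_univ j)
  rw [h1] at h2
  exact (mul_pos hk' hj).not_ge h2

omit [DecidableEq T] in
/-- If a nonnegative matrix has the eigenvalue `r` with a positive eigenvector, then `r ≤ c` as soon
as `A w ≤ c w` for some positive `w`. -/
lemma eigenvalue_le_of_mulVec_le [Nonempty T] (hA : ∀ i j, 0 ≤ A i j) {r c : ℝ} {h w : T → ℝ}
    (hh : ∀ i, 0 < h i) (hr : A *ᵥ h = r • h) (hw : ∀ i, 0 < w i)
    (hc : ∀ i, (A *ᵥ w) i ≤ c * w i) : r ≤ c := by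
  -- The multiple (h i / w i) w lies above h and touches it at i, where A h and A w are compared.
  obtain ⟨i, hi⟩ := Finite.exists_max fun i => h i / w i
  have hm : 0 < h i / w i := div_pos (hh i) (hw i)
  have h1 : r * h i ≤ (h i / w i) * (c * w i) :=
    calc r * h i = (A *ᵥ h) i := by rw [hr]; rfl
      _ ≤ ∑ j, (h i / w i) * (A i j * w j) := by
        rw [mulVec_apply_eq_sum]
        refine sum_le_sum fun j _ => ?_
        rw [mul_left_comm]
        exact mul_le_mul_of_nonneg_left ((div_le_iff₀ (hw j)).1 (hi j)) (hA i j)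
      _ = (h i / w i) * (A *ᵥ w) i := by rw [mulVec_apply_eq_sum, mul_sum]
      _ ≤ _ := mul_le_mul_of_nonneg_left (hc i) hm.le
  have h2 : (h i / w i) * (c * w i) = c * h i := by
    have := (hw i).ne'
    field_simp
  rw [h2] at h1
  exact le_of_mul_le_mul_right h1 (hh i)

/-- In the sup norm weighted by 1/h the matrix has norm at most r, so no complex eigenvalue exceeds
r in modulus. Any positive eigenvector thus identifies the spectral radius. -/
lemma perronEigenvalue_eq [Nonempty T] (hA : ∀ i j, 0 ≤ A i j) {r : ℝ} (hr0 : 0 ≤ r) {h : T → ℝ}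
    (hh : ∀ i, 0 < h i) (hr : A *ᵥ h = r • h) : perronEigenvalue A = r := by
  set M := A.map (algebraMap ℝ ℂ) with hM
  suffices hs : spectralRadius ℂ M = ENNReal.ofReal r by
    rw [perronEigenvalue, hs, ENNReal.toReal_ofReal hr0]
  have hmem : ∀ μ : ℂ, μ ∈ spectrum ℂ M ↔ ∃ v : T → ℂ, v ≠ 0 ∧ M *ᵥ v = μ • v := by
    intro μ
    rw [← Matrix.spectrum_toLin', ← Module.End.hasEigenvalue_iff_mem_spectrum]
    constructor
    · intro hμ
      obtain ⟨v, hv⟩ := hμ.exists_hasEigenvector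
      exact ⟨v, hv.2, by simpa using hv.apply_eq_smul⟩
    · rintro ⟨v, hv, hv'⟩
      exact Module.End.hasEigenvalue_of_hasEigenvector
        ⟨Module.End.mem_eigenspace_iff.2 (by simpa using hv'), hv⟩
  refine le_antisymm ?_ ?_
  · refine iSup₂_le fun μ hμ => ?_
    obtain ⟨v, hv, hμv⟩ := (hmem μ).1 hμ
    rw [← ENNReal.ofReal_coe_nnreal, coe_nnnorm]
    refine ENNReal.ofReal_le_ofReal ?_
    obtain ⟨i, hi⟩ := Finite.exists_max fun i => ‖v i‖ / h i
    have hvi : 0 < ‖v i‖ := by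
      obtain ⟨j, hj⟩ := Function.ne_iff.1 hv
      have h1 : 0 < ‖v j‖ / h j := div_pos (norm_pos_iff.2 hj) (hh j)
      exact (div_pos_iff_of_pos_right (hh i)).1 (h1.trans_le (hi j))
    have h1 : ‖μ‖ * ‖v i‖ ≤ (‖v i‖ / h i) * (r * h i) :=
      calc ‖μ‖ * ‖v i‖ = ‖(M *ᵥ v) i‖ := by rw [hμv]; simp
        _ ≤ ∑ j, (‖v i‖ / h i) * (A i j * h j) := by
          rw [mulVec_apply_eq_sum]
          refine (norm_sum_le _ _).trans (sum_le_sum fun j _ => ?_)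
          rw [mul_left_comm, norm_mul, hM]
          simp only [map_apply, Complex.coe_algebraMap, Complex.norm_real, Real.norm_eq_abs,
            abs_of_nonneg (hA i j)]
          exact mul_le_mul_of_nonneg_left ((div_le_iff₀ (hh j)).1 (hi j)) (hA i j)
        _ = (‖v i‖ / h i) * (A *ᵥ h) i := by rw [mulVec_apply_eq_sum, mul_sum]
        _ = _ := by rw [hr]; rfl
    have h2 : (‖v i‖ / h i) * (r * h i) = r * ‖v i‖ := by
      have := (hh i).ne'
      field_simp
    rw [h2] at h1
    exact le_of_mul_le_mul_right h1 hvi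
  · have : (r : ℂ) ∈ spectrum ℂ M := by
      refine (hmem _).2 ⟨fun i => (h i : ℂ), fun h0 => ?_, funext fun i => ?_⟩
      · obtain ⟨i⟩ := ‹Nonempty T›
        have := congrFun h0 i
        simp only [Pi.zero_apply, Complex.ofReal_eq_zero] at this
        exact (hh i).ne' this
      · have h1 := congrFun hr i
        rw [mulVec_apply_eq_sum] at h1 ⊢
        simp only [hM, map_apply, Complex.coe_algebraMap, Pi.smul_apply, smul_eq_mul] at h1 ⊢
        exact_mod_cast h1
    refine le_trans ?_ (le_iSup₂ (f := fun (k : ℂ) (_ : k ∈ spectrum ℂ M) => (‖k‖₊ : ENNReal))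
      (r : ℂ) this)
    rw [← ENNReal.ofReal_coe_nnreal, coe_nnnorm, Complex.norm_real, Real.norm_eq_abs,
      abs_of_nonneg hr0]

lemma exists_perronEigenvector [Nonempty T] (hA : A.IsIrreducible) :
    0 < perronEigenvalue A ∧ ∃ h : T → ℝ, (∀ i, 0 < h i) ∧ A *ᵥ h = perronEigenvalue A • h := by
  obtain ⟨r, hr, h, hh, he⟩ := exists_pos_eigenvector hA
  rw [perronEigenvalue_eq hA.nonneg hr.le hh he]
  exact ⟨hr, h, hh, he⟩

lemma perronEigenvalue_le [Nonempty T] (hA : A.IsIrreducible) {c : ℝ} {w : T → ℝ}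
    (hw : ∀ i, 0 < w i) (hc : ∀ i, (A *ᵥ w) i ≤ c * w i) : perronEigenvalue A ≤ c := by
  obtain ⟨_, h, hh, he⟩ := exists_perronEigenvector hA
  exact eigenvalue_le_of_mulVec_le hA.nonneg hh he hw hc

/-- The Perron–Frobenius eigenvalue is geometrically simple. -/
lemma eq_smul_of_eigenvector [Nonempty T] (hA : A.IsIrreducible) {r : ℝ} (hr0 : 0 ≤ r)
    {h v : T → ℝ} (hh : ∀ i, 0 < h i) (hr : A *ᵥ h = r • h) (hv : A *ᵥ v = r • v) :
    ∃ c : ℝ, v = c • h := by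
  -- The difference c h - v is then a nonnegative eigenvector vanishing at i; if nonzero it would be
  -- positive everywhere.
  obtain ⟨i, hi⟩ := Finite.exists_max fun i => v i / h i
  refine ⟨v i / h i, ?_⟩
  by_contra hne
  have hge : ∀ j, 0 ≤ ((v i / h i) • h - v) j := fun j =>
    sub_nonneg.2 ((div_le_iff₀ (hh j)).1 (hi j))
  obtain ⟨j, hj⟩ : ∃ j, 0 < ((v i / h i) • h - v) j := by
    by_contra! hcon
    exact hne (sub_eq_zero.1 (funext fun j => le_antisymm (hcon j) (hge j))).symm
  have h1 := pos_of_eigenvector hA hr0 hge hj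
    (by rw [mulVec_sub, mulVec_smul, hr, hv, smul_comm, smul_sub]) i
  have := (hh i).ne'
  simp only [Pi.sub_apply, Pi.smul_apply, smul_eq_mul] at h1
  rw [div_mul_cancel₀ _ this, sub_self] at h1
  exact lt_irrefl _ h1

/-- The Fredholm alternative at the Perron–Frobenius eigenvalue. -/
lemma exists_mulVec_add_eq [Nonempty T] (hA : A.IsIrreducible) {r : ℝ} (hr0 : 0 ≤ r)
    {h : T → ℝ} (hh : ∀ i, 0 < h i) (hr : A *ᵥ h = r • h) (b : T → ℝ) :
    ∃ (s : ℝ) (v : T → ℝ), A *ᵥ v + b = r • v + s • h := by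
  set L : (T → ℝ) →ₗ[ℝ] (T → ℝ) := A.mulVecLin - r • LinearMap.id with hL
  have hLv : ∀ v, L v = A *ᵥ v - r • v := fun v => by simp [hL]
  have hker : Module.finrank ℝ (LinearMap.ker L) ≤ 1 := by
    refine finrank_le_one ⟨h, by simp [hLv, hr]⟩ fun w => ?_
    obtain ⟨c, hc⟩ := eq_smul_of_eigenvector hA hr0 hh hr
      (sub_eq_zero.1 ((hLv w).symm.trans w.2))
    exact ⟨c, Subtype.ext hc.symm⟩
  -- At a maximum i of v / h one has (A v) i ≤ r v i, so A v - r v is not positive at i. As the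
  -- kernel is at most a line, range and span of h then fill the space.
  have hnot : h ∉ LinearMap.range L := by
    rintro ⟨v, hv⟩
    rw [hLv] at hv
    obtain ⟨i, hi⟩ := Finite.exists_max fun i => v i / h i
    have h1 : (A *ᵥ v) i ≤ (v i / h i) * (A *ᵥ h) i := by
      rw [mulVec_apply_eq_sum, mulVec_apply_eq_sum, mul_sum]
      refine sum_le_sum fun j _ => ?_
      rw [mul_left_comm]
      exact mul_le_mul_of_nonneg_left ((div_le_iff₀ (hh j)).1 (hi j)) (hA.nonneg i j)
    have h2 := congrFun hv i
    have h3 := hh i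
    have h4 : v i / h i * (r * h i) = r * v i := by field_simp
    rw [hr] at h1
    simp only [Pi.sub_apply, Pi.smul_apply, smul_eq_mul] at h1 h2
    linarith
  have htop : LinearMap.range L ⊔ Submodule.span ℝ {h} = ⊤ := by
    have hne : h ≠ 0 := by
      obtain ⟨i⟩ := ‹Nonempty T›
      exact fun h0 => (hh i).ne' (congrFun h0 i)
    refine Submodule.eq_top_of_finrank_eq (le_antisymm (Submodule.finrank_le _) ?_)
    have hdisj : LinearMap.range L ⊓ Submodule.span ℝ {h} = ⊥ := by
      rw [← disjoint_iff]
      exact (Submodule.disjoint_span_singleton' hne).2 hnot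
    have e1 := Submodule.finrank_sup_add_finrank_inf_eq (LinearMap.range L) (Submodule.span ℝ {h})
    rw [hdisj, finrank_bot, finrank_span_singleton hne] at e1
    have e2 := L.finrank_range_add_finrank_ker
    omega
  have hb : b ∈ LinearMap.range L ⊔ Submodule.span ℝ {h} := htop ▸ Submodule.mem_top
  obtain ⟨_, ⟨v, rfl⟩, _, hz, hvz⟩ := Submodule.mem_sup.1 hb
  obtain ⟨s, rfl⟩ := Submodule.mem_span_singleton.1 hz
  refine ⟨s, -v, ?_⟩
  rw [← hvz, hLv, mulVec_neg]
  module

end PerronFrobenius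

/-! ### The pressure: convexity, comparison with cycle means, uniqueness of subgradients. -/

section Pressure

open Matrix Finset

variable {T : Type*} [Fintype T] [DecidableEq T] {d : ℕ}

/-- The matrix `{u(i, j) exp ⟨l, f(j)⟩}`. -/
noncomputable def tilt (u : Matrix T T ℝ) (f : T → Fin d → ℝ) (l : Fin d → ℝ) : Matrix T T ℝ :=
  Matrix.of fun i j => u i j * Real.exp (l ⬝ᵥ f j)

/-- The logarithm of the Perron–Frobenius eigenvalue of the tilted matrix. -/
noncomputable def pressure (u : Matrix T T ℝ) (f : T → Fin d → ℝ) (l : Fin d → ℝ) : ℝ :=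
  Real.log (perronEigenvalue (tilt u f l))

/-- The averages of `f` over the cycles of maps along the positive entries of `u`. -/
def cycleMeans (u : Matrix T T ℝ) (f : T → Fin d → ℝ) : Set (Fin d → ℝ) :=
  {x | ∃ (σ : T → T) (i : T) (n : Fin (Fintype.card T + 1)), (∀ j, 0 < u j (σ j)) ∧ 0 < (n : ℕ) ∧
    σ^[n] i = i ∧ ((n : ℕ) : ℝ)⁻¹ • ∑ k ∈ range n, f (σ^[k + 1] i) = x}

variable {u : Matrix T T ℝ} {f : T → Fin d → ℝ}

omit [DecidableEq T] in
lemma tilt_mulVec_apply (l : Fin d → ℝ) (w : T → ℝ) (i : T) :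
    (tilt u f l *ᵥ w) i = ∑ j, u i j * Real.exp (l ⬝ᵥ f j) * w j := by
  simp [tilt, mulVec_apply_eq_sum]

omit [Fintype T] [DecidableEq T] in
lemma tilt_isIrreducible (hu : u.IsIrreducible) (l : Fin d → ℝ) : (tilt u f l).IsIrreducible := by
  refine ⟨fun i j => mul_nonneg (hu.nonneg i j) (Real.exp_pos _).le, ?_⟩
  have : toQuiver (tilt u f l) = toQuiver u := by
    simp [toQuiver, tilt, Real.exp_pos]
  rw [this]
  exact hu.connected

lemma exists_pressure_eigenvector [Nonempty T] (hu : u.IsIrreducible) (l : Fin d → ℝ) :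
    ∃ h : T → ℝ, (∀ i, 0 < h i) ∧ tilt u f l *ᵥ h = Real.exp (pressure u f l) • h := by
  obtain ⟨h0, h⟩ := exists_perronEigenvector (tilt_isIrreducible (f := f) hu l)
  rwa [pressure, Real.exp_log h0]

/-- Upper bounds need only a positive supersolution w. Different choices of w give convexity, the
first-order expansion and the substochastic bound. -/
lemma pressure_le [Nonempty T] (hu : u.IsIrreducible) {l : Fin d → ℝ} {c : ℝ} {w : T → ℝ}
    (hw : ∀ i, 0 < w i) (hc : ∀ i, (tilt u f l *ᵥ w) i ≤ Real.exp c * w i) :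
    pressure u f l ≤ c := by
  have h := tilt_isIrreducible (f := f) hu l
  rw [pressure, Real.log_le_iff_le_exp (exists_perronEigenvector h).1]
  exact perronEigenvalue_le h hw hc

lemma convexOn_pressure [Nonempty T] (hu : u.IsIrreducible) :
    ConvexOn ℝ Set.univ (pressure u f) := by
  refine ⟨convex_univ, fun l _ m _ a b ha hb hab => ?_⟩
  obtain ⟨h, hh, hl⟩ := exists_pressure_eigenvector (f := f) hu l
  obtain ⟨k, hk, hm⟩ := exists_pressure_eigenvector (f := f) hu m
  set p := pressure u f l
  set q := pressure u f m
  -- The weighted geometric mean of the two eigenvectors is a supersolution by Hölder, here weighted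
  -- AM–GM on terms normalized by their row totals.
  refine pressure_le hu (w := fun i => h i ^ a * k i ^ b)
    (fun i => mul_pos (Real.rpow_pos_of_pos (hh i) a) (Real.rpow_pos_of_pos (hk i) b)) fun i => ?_
  rw [tilt_mulVec_apply]
  have hl' := congrFun hl i
  have hm' := congrFun hm i
  rw [tilt_mulVec_apply] at hl' hm'
  simp only [Pi.smul_apply, smul_eq_mul] at hl' hm' ⊢
  have hP : 0 < Real.exp p * h i := mul_pos (Real.exp_pos _) (hh i)
  have hQ : 0 < Real.exp q * k i := mul_pos (Real.exp_pos _) (hk i)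
  have hPQ : Real.exp (a * p + b * q) * (h i ^ a * k i ^ b)
      = (Real.exp p * h i) ^ a * (Real.exp q * k i) ^ b := by
    rw [Real.mul_rpow (Real.exp_pos _).le (hh i).le, Real.mul_rpow (Real.exp_pos _).le (hk i).le,
      ← Real.exp_mul, ← Real.exp_mul, Real.exp_add, mul_comm p, mul_comm q]
    ring
  have key : ∀ j, u i j * Real.exp ((a • l + b • m) ⬝ᵥ f j) * (h j ^ a * k j ^ b)
      ≤ ((Real.exp p * h i) ^ a * (Real.exp q * k i) ^ b) *
        (a * (u i j * Real.exp (l ⬝ᵥ f j) * h j / (Real.exp p * h i)) +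
         b * (u i j * Real.exp (m ⬝ᵥ f j) * k j / (Real.exp q * k i))) := by
    intro j
    have hx := div_nonneg (mul_nonneg (mul_nonneg (hu.nonneg i j) (Real.exp_pos (l ⬝ᵥ f j)).le)
      (hh j).le) hP.le
    have hy := div_nonneg (mul_nonneg (mul_nonneg (hu.nonneg i j) (Real.exp_pos (m ⬝ᵥ f j)).le)
      (hk j).le) hQ.le
    refine le_trans (le_of_eq ?_) (mul_le_mul_of_nonneg_left
      (Real.geom_mean_le_arith_mean2_weighted ha hb hx hy hab) (by positivity))
    rw [Real.div_rpow (by have := hu.nonneg i j; have := hh j; positivity) hP.le,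
      Real.div_rpow (by have := hu.nonneg i j; have := hk j; positivity) hQ.le]
    have e1 : (Real.exp p * h i) ^ a ≠ 0 := (Real.rpow_pos_of_pos hP a).ne'
    have e2 : (Real.exp q * k i) ^ b ≠ 0 := (Real.rpow_pos_of_pos hQ b).ne'
    -- At a zero entry this survives the convention 0 ^ 0 = 1, since a and b are not both zero.
    have e3 : u i j = u i j ^ a * u i j ^ b := by
      rcases (hu.nonneg i j).eq_or_lt with h0 | h0
      · rw [← h0]
        rcases eq_or_ne a 0 with rfl | ha0
        · rw [zero_add] at hab
          simp [hab]
        · simp [Real.zero_rpow ha0]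
      · rw [← Real.rpow_add h0, hab, Real.rpow_one]
    have e4 : Real.exp ((a • l + b • m) ⬝ᵥ f j)
        = Real.exp (l ⬝ᵥ f j) ^ a * Real.exp (m ⬝ᵥ f j) ^ b := by
      rw [← Real.exp_mul, ← Real.exp_mul, ← Real.exp_add, add_dotProduct, smul_dotProduct,
        smul_dotProduct, smul_eq_mul, smul_eq_mul, mul_comm a, mul_comm b]
    have n1 := (Real.exp_pos (l ⬝ᵥ f j)).le
    have n2 := (Real.exp_pos (m ⬝ᵥ f j)).le
    rw [Real.mul_rpow (mul_nonneg (hu.nonneg i j) n1) (hh j).le,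
      Real.mul_rpow (hu.nonneg i j) n1, Real.mul_rpow (mul_nonneg (hu.nonneg i j) n2) (hk j).le,
      Real.mul_rpow (hu.nonneg i j) n2, e4]
    nth_rewrite 1 [e3]
    field_simp
  refine (sum_le_sum fun j _ => key j).trans (le_of_eq ?_)
  rw [← mul_sum, sum_add_distrib, ← mul_sum, ← mul_sum, ← sum_div, ← sum_div, hl', hm',
    div_self hP.ne', div_self hQ.ne', mul_one, mul_one, hab, mul_one, hPQ]

omit [DecidableEq T] in
lemma finite_cycleMeans : (cycleMeans u f).Finite := by
  classical
  refine (Set.finite_range fun q : (T → T) × T × Fin (Fintype.card T + 1) =>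
    ((q.2.2 : ℕ) : ℝ)⁻¹ • ∑ k ∈ range q.2.2, f (q.1^[k + 1] q.2.1)).subset ?_
  rintro x ⟨σ, i, n, -, -, -, rfl⟩
  exact ⟨(σ, i, n), rfl⟩

-- The differences of H telescope around the cycle; H will be plus or minus the logarithm of an
-- eigenvector.
omit [Fintype T] [DecidableEq T] in
lemma sum_orbit_nonpos {σ : T → T} {i : T} {n : ℕ} (hσ : σ^[n] i = i) {G H : T → ℝ}
    (hG : ∀ j, G j ≤ H j - H (σ j)) : ∑ k ∈ range n, G (σ^[k] i) ≤ 0 := by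
  calc ∑ k ∈ range n, G (σ^[k] i) ≤ ∑ k ∈ range n, (H (σ^[k] i) - H (σ^[k + 1] i)) := by
        refine sum_le_sum fun k _ => ?_
        rw [Function.iterate_succ_apply']
        exact hG _
    _ = 0 := by
        rw [sum_range_sub' fun k => H (σ^[k] i)]
        simp [hσ]

omit [Fintype T] [DecidableEq T] in
lemma dotProduct_mean (l : Fin d → ℝ) (σ : T → T) (i : T) {n : ℕ} (hn : 0 < n) (c : ℝ) :
    ∑ k ∈ range n, (l ⬝ᵥ f (σ (σ^[k] i)) + c)
      = n * (l ⬝ᵥ ((n : ℝ)⁻¹ • ∑ k ∈ range n, f (σ^[k + 1] i)) + c) := by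
  have : (n : ℝ) ≠ 0 := by positivity
  rw [sum_add_distrib, sum_const, card_range, nsmul_eq_mul, dotProduct_smul, dotProduct_sum,
    smul_eq_mul, mul_add, mul_inv_cancel_left₀ this]
  simp only [Function.iterate_succ_apply']

/-- The pressure agrees with the support function of the cycle means up to a bounded error. -/
lemma exists_pressure_bound [Nonempty T] (hu : u.IsIrreducible) :
    ∃ M : ℝ, (∀ x ∈ cycleMeans u f, ∀ l, l ⬝ᵥ x ≤ pressure u f l + M) ∧
      ∀ l, ∃ x ∈ cycleMeans u f, pressure u f l ≤ l ⬝ᵥ x + M := by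
  obtain ⟨δ, hδ0, hδ⟩ : ∃ δ : ℝ, 0 < δ ∧ ∀ i j, 0 < u i j → δ ≤ u i j := by
    by_cases hne : (univ.filter fun p : T × T => 0 < u p.1 p.2).Nonempty
    · obtain ⟨p, hp, hmin⟩ := exists_min_image _ (fun p : T × T => u p.1 p.2) hne
      exact ⟨_, (mem_filter.1 hp).2, fun i j hij => hmin (i, j) (by simp [hij])⟩
    · refine ⟨1, one_pos, fun i j hij => (hne ⟨(i, j), by simp [hij]⟩).elim⟩
  set D : ℝ := Fintype.card T * (∑ i, ∑ j, u i j + 1)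
  have hu1 : ∀ i j, u i j ≤ ∑ i, ∑ j, u i j + 1 := fun i j => by
    have h1 : u i j ≤ ∑ j, u i j :=
      single_le_sum (f := fun j => u i j) (fun j _ => hu.nonneg i j) (mem_univ j)
    have h2 : ∑ j, u i j ≤ ∑ i, ∑ j, u i j := single_le_sum (f := fun i => ∑ j, u i j)
      (fun i _ => sum_nonneg fun j _ => hu.nonneg i j) (mem_univ i)
    linarith
  refine ⟨max (-Real.log δ) (Real.log D), ?_, fun l => ?_⟩
  · rintro x ⟨σ, i, n, hσ, hn, hi, rfl⟩ l
    obtain ⟨h, hh, he⟩ := exists_pressure_eigenvector (f := f) hu l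
    have h1 : ∀ j, l ⬝ᵥ f (σ j) + (Real.log δ - pressure u f l)
        ≤ Real.log (h j) - Real.log (h (σ j)) := by
      intro j
      have h2 : δ * Real.exp (l ⬝ᵥ f (σ j)) * h (σ j) ≤ Real.exp (pressure u f l) * h j := by
        have h3 := congrFun he j
        rw [tilt_mulVec_apply] at h3
        -- Only the edge from j to σ j is kept in the eigenvector equation.
        have h4 := single_le_sum (f := fun k => u j k * Real.exp (l ⬝ᵥ f k) * h k)
          (fun k _ => mul_nonneg (mul_nonneg (hu.nonneg j k) (Real.exp_pos _).le) (hh k).le)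
          (mem_univ (σ j))
        rw [h3] at h4
        refine le_trans ?_ h4
        have := hδ j (σ j) (hσ j)
        have := hh (σ j)
        gcongr
      have h5 := Real.log_le_log (by have := hh (σ j); positivity) h2
      rw [Real.log_mul (by positivity) (hh _).ne', Real.log_mul hδ0.ne' (Real.exp_ne_zero _),
        Real.log_mul (Real.exp_ne_zero _) (hh _).ne', Real.log_exp, Real.log_exp] at h5
      linarith
    have h6 := sum_orbit_nonpos hi h1
    rw [dotProduct_mean l σ i hn] at h6
    have hn' : (0 : ℝ) < (n : ℕ) := by exact_mod_cast hn
    have h7 := nonpos_of_mul_nonpos_right h6 hn'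
    have := le_max_left (-Real.log δ) (Real.log D)
    linarith
  · obtain ⟨h, hh, he⟩ := exists_pressure_eigenvector (f := f) hu l
    -- Let σ choose the largest term in each row of the eigenvector equation, at least a 1/card
    -- share of the total. By pigeonhole an orbit of σ enters a cycle.
    have hex : ∀ i, ∃ j, ∀ k, u i k * Real.exp (l ⬝ᵥ f k) * h k
        ≤ u i j * Real.exp (l ⬝ᵥ f j) * h j := fun i =>
      Finite.exists_max fun j => u i j * Real.exp (l ⬝ᵥ f j) * h j
    choose σ hσ using hex
    have h1 : ∀ j, Real.exp (pressure u f l) * h j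
        ≤ Fintype.card T * (u j (σ j) * Real.exp (l ⬝ᵥ f (σ j)) * h (σ j)) := by
      intro j
      have h3 := congrFun he j
      rw [tilt_mulVec_apply] at h3
      simp only [Pi.smul_apply, smul_eq_mul] at h3
      rw [← h3]
      refine (sum_le_sum fun k _ => hσ j k).trans ?_
      simp
    have hpos : ∀ j, 0 < u j (σ j) := by
      intro j
      refine (hu.nonneg j (σ j)).lt_of_ne' fun h0 => ?_
      have := h1 j
      rw [h0, zero_mul, zero_mul, mul_zero] at this
      exact (mul_pos (Real.exp_pos _) (hh j)).not_ge this
    have hsum : 0 < ∑ i, ∑ j, u i j + 1 :=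
      add_pos_of_nonneg_of_pos (sum_nonneg fun i _ => sum_nonneg fun j _ => hu.nonneg i j) one_pos
    have hD : 0 < D := mul_pos (by exact_mod_cast Fintype.card_pos) hsum
    have h2 : ∀ j, -(l ⬝ᵥ f (σ j) + (Real.log D - pressure u f l))
        ≤ -Real.log (h j) - -Real.log (h (σ j)) := by
      intro j
      have h3 : Real.exp (pressure u f l) * h j ≤ D * Real.exp (l ⬝ᵥ f (σ j)) * h (σ j) := by
        refine (h1 j).trans ?_
        have := hu1 j (σ j)
        have := hh (σ j)
        rw [mul_assoc D, mul_assoc (Fintype.card T : ℝ), mul_assoc (u j (σ j))]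
        gcongr
      have h5 := Real.log_le_log (by have := hh j; positivity) h3
      rw [Real.log_mul (Real.exp_ne_zero _) (hh _).ne', Real.log_mul (by positivity) (hh _).ne',
        Real.log_mul hD.ne' (Real.exp_ne_zero _), Real.log_exp, Real.log_exp] at h5
      linarith
    obtain ⟨i₀⟩ := ‹Nonempty T›
    obtain ⟨a, b, hab, hfab⟩ := Fintype.exists_ne_map_eq_of_card_lt
      (fun k : Fin (Fintype.card T + 1) => σ^[k] i₀) (by simp)
    wlog hlt : a < b generalizing a b
    · exact this b a hab.symm hfab.symm (lt_of_le_of_ne (not_lt.1 hlt) hab.symm)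
    have hlt' : (a : ℕ) < b := hlt
    have hper : σ^[(b : ℕ) - a] (σ^[a] i₀) = σ^[a] i₀ := by
      rw [← Function.iterate_add_apply, Nat.sub_add_cancel hlt'.le]
      exact hfab.symm
    have hn : 0 < (b : ℕ) - a := Nat.sub_pos_of_lt hlt'
    refine ⟨_, ⟨σ, σ^[a] i₀, ⟨b - a, by omega⟩, hpos, hn, hper, rfl⟩, ?_⟩
    have h6 := sum_orbit_nonpos hper h2
    rw [sum_neg_distrib, dotProduct_mean l σ _ hn, neg_nonpos] at h6
    have hn' : (0 : ℝ) < ((b : ℕ) - a : ℕ) := by exact_mod_cast hn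
    have h7 := nonneg_of_mul_nonneg_right h6 hn'
    have := le_max_right (-Real.log δ) (Real.log D)
    simp only
    linarith

/-- The pressure has at most one subgradient at each point. -/
lemma subgradient_pressure_unique [Nonempty T] (hu : u.IsIrreducible) {l x y : Fin d → ℝ}
    (hx : ∀ l', pressure u f l + (l' - l) ⬝ᵥ x ≤ pressure u f l')
    (hy : ∀ l', pressure u f l + (l' - l) ⬝ᵥ y ≤ pressure u f l') : x = y := by
  suffices H : ∀ m : Fin d → ℝ, ∃ a : ℝ, ∀ x : Fin d → ℝ,
      (∀ l', pressure u f l + (l' - l) ⬝ᵥ x ≤ pressure u f l') → m ⬝ᵥ x = a by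
    funext k
    obtain ⟨a, ha⟩ := H (Pi.single k 1)
    have := (ha x hx).trans (ha y hy).symm
    simpa using this
  intro m
  have hirr := tilt_isIrreducible (f := f) hu l
  obtain ⟨h, hh, he⟩ := exists_pressure_eigenvector (f := f) hu l
  set r := Real.exp (pressure u f l) with hr
  have hr0 : 0 < r := Real.exp_pos _
  -- Here v is the first-order correction of h in direction m, and s / r the resulting slope: with
  -- test vector h + t v, every ratio N i t / W i t equals exp(p(l) + t s / r + o(t)).
  obtain ⟨s, v, hsv⟩ := exists_mulVec_add_eq hirr hr0.le hh he
    (fun i => ∑ j, u i j * Real.exp (l ⬝ᵥ f j) * ((m ⬝ᵥ f j) * h j))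
  set W : T → ℝ → ℝ := fun i t => h i + t * v i with hW
  set N : T → ℝ → ℝ := fun i t =>
    ∑ j, u i j * Real.exp (l ⬝ᵥ f j) * (Real.exp (t * (m ⬝ᵥ f j)) * W j t) with hN
  have hW0 : ∀ i, W i 0 = h i := fun i => by simp [hW]
  have hN0 : ∀ i, N i 0 = r * h i := fun i => by
    have := congrFun he i
    rw [tilt_mulVec_apply] at this
    simpa [hN, hW0] using this
  have dW : ∀ i, HasDerivAt (W i) (v i) 0 := fun i =>
    (((hasDerivAt_id' (0 : ℝ)).mul_const (v i)).const_add (h i)).congr_deriv (one_mul _)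
  have dN : ∀ i, HasDerivAt (N i) (r * v i + s * h i) 0 := fun i => by
    have h1 := congrFun hsv i
    simp only [Pi.add_apply, Pi.smul_apply, smul_eq_mul, tilt_mulVec_apply] at h1
    rw [← h1, ← sum_add_distrib]
    refine HasDerivAt.fun_sum fun j _ => ?_
    have h2 : HasDerivAt (fun t : ℝ => Real.exp (t * (m ⬝ᵥ f j))) (m ⬝ᵥ f j) 0 := by
      simpa using ((hasDerivAt_id (0 : ℝ)).mul_const (m ⬝ᵥ f j)).exp
    have h3 := (h2.mul (dW j)).const_mul (u i j * Real.exp (l ⬝ᵥ f j))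
    refine h3.congr_deriv ?_
    rw [hW0, zero_mul, Real.exp_zero]
    ring
  have dL : ∀ i, HasDerivAt (fun t => Real.log (N i t) - Real.log (W i t)) (s / r) 0 := fun i => by
    have h1 := hh i
    have h2 := ((dN i).log (by rw [hN0]; positivity)).sub ((dW i).log (by rw [hW0]; positivity))
    refine h2.congr_deriv ?_
    rw [hN0, hW0]
    field_simp
    ring
  refine ⟨s / r, fun x hx => ?_⟩
  -- An upper bound on p(l + t m) is enough: t has both signs, which forces m·x = s / r.
  have hsmall : ∀ ε : ℝ, 0 < ε → ∀ᶠ t in 𝓝 (0 : ℝ), t * (m ⬝ᵥ x - s / r) ≤ ε * |t| := by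
    intro ε hε
    have e1 : ∀ᶠ t in 𝓝 (0 : ℝ), ∀ i, 0 < W i t := eventually_all.2 fun i =>
      (dW i).continuousAt.eventually (lt_mem_nhds (by rw [hW0]; exact hh i))
    have e2 : ∀ᶠ t in 𝓝 (0 : ℝ), ∀ i, 0 < N i t := eventually_all.2 fun i =>
      (dN i).continuousAt.eventually (lt_mem_nhds (by rw [hN0]; exact mul_pos hr0 (hh i)))
    have e3 : ∀ᶠ t in 𝓝 (0 : ℝ), ∀ i, Real.log (N i t) - Real.log (W i t)
        ≤ pressure u f l + t * (s / r) + ε * |t| := eventually_all.2 fun i => by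
      filter_upwards [(hasDerivAt_iff_isLittleO.1 (dL i)).def hε] with t ht
      have h1 := (le_abs_self _).trans ht
      have h2 := hh i
      rw [hN0, hW0, Real.log_mul hr0.ne' h2.ne', hr, Real.log_exp] at h1
      simp only [sub_zero, smul_eq_mul, Real.norm_eq_abs] at h1
      linarith
    filter_upwards [e1, e2, e3] with t h1 h2 h3
    have h4 := pressure_le (f := f) (l := l + t • m) hu h1
      (c := pressure u f l + t * (s / r) + ε * |t|) fun i => by
        have h5 : (tilt u f (l + t • m) *ᵥ fun i => W i t) i = N i t := by
          rw [tilt_mulVec_apply]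
          refine sum_congr rfl fun j _ => ?_
          rw [add_dotProduct, smul_dotProduct, smul_eq_mul, Real.exp_add]
          ring
        rw [h5, ← Real.exp_log (h1 i), ← Real.exp_add, ← Real.log_le_iff_le_exp (h2 i)]
        linarith [h3 i]
    have h6 := hx (l + t • m)
    rw [add_sub_cancel_left, smul_dotProduct, smul_eq_mul] at h6
    linarith
  by_contra hne
  have hε : 0 < |m ⬝ᵥ x - s / r| / 2 := by
    have := abs_pos.2 (sub_ne_zero.2 hne)
    positivity
  obtain ⟨η, hη, hball⟩ := Metric.eventually_nhds_iff.1 (hsmall _ hε)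
  have hp := hball (y := η / 2) (by rw [dist_zero_right, Real.norm_eq_abs, abs_of_pos] <;> linarith)
  have hm := hball (y := -(η / 2))
    (by rw [dist_zero_right, Real.norm_eq_abs, abs_neg, abs_of_pos] <;> linarith)
  rw [abs_neg] at hm
  rw [abs_of_pos (half_pos hη)] at hp hm
  rcases abs_cases (m ⬝ᵥ x - s / r) with ⟨ha, _⟩ | ⟨ha, _⟩ <;> rw [ha] at hp hm hε <;> nlinarith

lemma pressure_zero_nonpos [Nonempty T] (hu : u.IsIrreducible) (hs : ∀ i, ∑ j, u i j ≤ 1) :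
    pressure u f 0 ≤ 0 :=
  pressure_le hu (w := fun _ => 1) (fun _ => one_pos) fun i => by
    simpa [tilt_mulVec_apply] using hs i

omit [DecidableEq T] in
/-- The cycle means lie in every convex set that contains the values of `f`. -/
lemma cycleMeans_subset {K : Set (Fin d → ℝ)} (hK : Convex ℝ K) (hf : ∀ i, f i ∈ K) :
    cycleMeans u f ⊆ K := by
  rintro x ⟨σ, i, n, -, hn, -, rfl⟩
  have hn' : (0 : ℝ) < (n : ℕ) := by exact_mod_cast hn
  rw [smul_sum]
  refine hK.sum_mem (fun _ _ => by positivity) ?_ fun k _ => hf _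
  rw [sum_const, card_range, nsmul_eq_mul, mul_inv_cancel₀ hn'.ne']

end Pressure

/-! ### Convex functions on polytopes and relative interiors. -/

section ConvexSets

open Set

variable {E : Type*} [NormedAddCommGroup E] [NormedSpace ℝ E]

/-- A convex function on a polytope is continuous if it is lower semicontinuous. -/
lemma continuousOn_convexHull_of_lowerSemicontinuousOn {V : Set E} (hV : V.Finite) {g : E → ℝ}
    (hg : ConvexOn ℝ (convexHull ℝ V) g) (hlsc : LowerSemicontinuousOn g (convexHull ℝ V)) {M : ℝ}
    (hM : ∀ x ∈ convexHull ℝ V, g x ≤ M) : ContinuousOn g (convexHull ℝ V) := by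
  refine continuousOn_iff_lower_upperSemicontinuousOn.2 ⟨hlsc, ?_⟩
  let _ := hV.fintype
  set Φ : (V → ℝ) →ₗ[ℝ] E := ∑ x : V, (LinearMap.proj (R := ℝ) x).smulRight x.1 with hΦ
  have himg : convexHull ℝ V = Φ '' stdSimplex ℝ V := hV.convexHull_eq_image
  have hΦc : Continuous Φ := LinearMap.continuous_on_pi _
  have hmem : ∀ a ∈ stdSimplex ℝ V, Φ a ∈ convexHull ℝ V := fun a ha =>
    himg ▸ mem_image_of_mem Φ ha
  -- Near a, a point b of the simplex dominates (1 - ε) a, so b = (1 - ε) a + ε r with r in the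
  -- simplex, and convexity gives g(Φ b) ≤ (1 - ε) g(Φ a) + ε M.
  have husc : UpperSemicontinuousOn (g ∘ Φ) (stdSimplex ℝ V) := by
    intro a ha c hc
    simp only [Function.comp_apply] at hc ⊢
    set D := c - g (Φ a) with hD
    set F := M - g (Φ a) with hF
    have hD0 : 0 < D := sub_pos.2 hc
    have hF0 : 0 ≤ F := sub_nonneg.2 (hM _ (hmem a ha))
    set ε := D / (D + F + 1) with hε
    have hε0 : 0 < ε := by positivity
    have hε1 : ε < 1 := (div_lt_one (by positivity)).2 (by linarith)
    have hεF : ε * F < D := by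
      rw [hε, div_mul_eq_mul_div, div_lt_iff₀ (by positivity)]
      nlinarith
    have hev : ∀ᶠ b in 𝓝[stdSimplex ℝ V] a, ∀ i, (1 - ε) * a i ≤ b i := by
      refine eventually_all.2 fun i => ?_
      rcases (ha.1 i).eq_or_lt with h0 | h0
      · filter_upwards [self_mem_nhdsWithin] with b hb
        rw [← h0, mul_zero]
        exact hb.1 i
      · refine ((continuous_apply i).continuousAt.eventually
          (lt_mem_nhds (show (1 - ε) * a i < a i by nlinarith))).filter_mono nhdsWithin_le_nhds
          |>.mono fun b hb => hb.le
    filter_upwards [hev, self_mem_nhdsWithin] with b hb hbΔ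
    set r : V → ℝ := ε⁻¹ • (b - (1 - ε) • a) with hr
    have hrΔ : r ∈ stdSimplex ℝ V := by
      refine ⟨fun i => mul_nonneg (inv_nonneg.2 hε0.le) (sub_nonneg.2 (hb i)), ?_⟩
      simp only [hr, Pi.smul_apply, Pi.sub_apply, smul_eq_mul]
      rw [← Finset.mul_sum, Finset.sum_sub_distrib, ← Finset.mul_sum, hbΔ.2, ha.2]
      field_simp
      ring
    have hbr : b = (1 - ε) • a + ε • r := by
      rw [hr, smul_inv_smul₀ hε0.ne', add_sub_cancel]
    have h1 := hg.2 (hmem a ha) (hmem r hrΔ) (sub_nonneg.2 hε1.le) hε0.le (sub_add_cancel 1 ε)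
    rw [← map_smul, ← map_smul, ← map_add, ← hbr] at h1
    have h2 := hM _ (hmem r hrΔ)
    simp only [smul_eq_mul] at h1
    nlinarith
  -- Upper level sets of g are images under Φ of compact sets, hence closed.
  rw [upperSemicontinuousOn_iff_preimage_Ici] at husc ⊢
  intro c
  obtain ⟨v, hv, hvc⟩ := husc c
  refine ⟨Φ '' (stdSimplex ℝ V ∩ v), ?_, ?_⟩
  · exact (((isCompact_stdSimplex ℝ V).inter_right hv).image hΦc).isClosed
  · rw [← hvc]
    ext x
    constructor
    · rintro ⟨hx, hxc⟩
      refine ⟨hx, ?_⟩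
      rw [himg] at hx
      obtain ⟨a, ha, rfl⟩ := hx
      exact ⟨a, ⟨ha, hxc⟩, rfl⟩
    · rintro ⟨hx, a, ⟨-, hac⟩, rfl⟩
      exact ⟨hx, hac⟩

lemma mem_intrinsicInterior_iff {s : Set E} {x : E} :
    x ∈ intrinsicInterior ℝ s ↔
      x ∈ s ∧ ∃ δ > 0, ∀ w ∈ vectorSpan ℝ s, ‖w‖ < δ → x + w ∈ s := by
  rw [mem_intrinsicInterior]
  constructor
  · rintro ⟨y, hy, rfl⟩
    have hys : y ∈ ((↑) ⁻¹' s : Set (affineSpan ℝ s)) := interior_subset hy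
    refine ⟨hys, ?_⟩
    obtain ⟨δ, hδ, hball⟩ := Metric.mem_nhds_iff.1 (mem_interior_iff_mem_nhds.1 hy)
    refine ⟨δ, hδ, fun w hw hwδ => ?_⟩
    have hmem : (y : E) + w ∈ affineSpan ℝ s := by
      rw [add_comm]
      exact AffineSubspace.vadd_mem_of_mem_direction (by rwa [direction_affineSpan]) y.2
    have : (⟨(y : E) + w, hmem⟩ : affineSpan ℝ s) ∈ Metric.ball y δ := by
      rw [Metric.mem_ball, Subtype.dist_eq, dist_eq_norm, add_sub_cancel_left]
      exact hwδ
    exact hball this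
  · rintro ⟨hx, δ, hδ, hw⟩
    refine ⟨⟨x, subset_affineSpan ℝ s hx⟩, ?_, rfl⟩
    rw [mem_interior_iff_mem_nhds, Metric.mem_nhds_iff]
    refine ⟨δ, hδ, fun z hz => ?_⟩
    rw [Metric.mem_ball, Subtype.dist_eq, dist_eq_norm] at hz
    have h1 : (z : E) - x ∈ vectorSpan ℝ s := by
      rw [← direction_affineSpan]
      exact AffineSubspace.vsub_mem_direction z.2 (subset_affineSpan ℝ s hx)
    have h2 := hw _ h1 hz
    rwa [add_sub_cancel] at h2

lemma combo_mem_intrinsicInterior {s : Set E} (hs : Convex ℝ s) {x z : E} (hx : x ∈ s)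
    (hz : z ∈ intrinsicInterior ℝ s) {a b : ℝ} (ha : 0 ≤ a) (hb : 0 < b) (hab : a + b = 1) :
    a • x + b • z ∈ intrinsicInterior ℝ s := by
  rw [mem_intrinsicInterior_iff] at hz ⊢
  obtain ⟨hz, δ, hδ, hw⟩ := hz
  refine ⟨hs hx hz ha hb.le hab, b * δ, mul_pos hb hδ, fun w hwm hwn => ?_⟩
  have h1 := hw (b⁻¹ • w) (Submodule.smul_mem _ _ hwm) (by
    rw [norm_smul, norm_inv, Real.norm_eq_abs, abs_of_pos hb]
    exact (inv_mul_lt_iff₀ hb).2 hwn)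
  have h2 := hs hx h1 ha hb.le hab
  rwa [smul_add, smul_inv_smul₀ hb.ne', ← add_assoc] at h2

lemma convex_intrinsicInterior {s : Set E} (hs : Convex ℝ s) :
    Convex ℝ (intrinsicInterior ℝ s) := by
  intro x hx y hy a b ha hb hab
  rcases hb.eq_or_lt with rfl | hb'
  · rw [add_zero] at hab
    simpa [hab] using hx
  · exact combo_mem_intrinsicInterior hs (intrinsicInterior_subset hx) hy ha hb' hab

end ConvexSets

/-! ### The Legendre transform of a pressure. -/

section Legendre

open Set

variable {d : ℕ}

lemma sq_norm_le_dotProduct_self (l : Fin d → ℝ) : ‖l‖ ^ 2 ≤ l ⬝ᵥ l := by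
  have h0 : 0 ≤ l ⬝ᵥ l := Finset.sum_nonneg fun i _ => mul_self_nonneg _
  have h1 : ‖l‖ ≤ √(l ⬝ᵥ l) := by
    refine (pi_norm_le_iff_of_nonneg (Real.sqrt_nonneg _)).2 fun i => ?_
    refine Real.abs_le_sqrt ?_
    rw [sq]
    exact Finset.single_le_sum (f := fun i => l i * l i) (fun i _ => mul_self_nonneg _)
      (Finset.mem_univ i)
  exact (Real.le_sqrt (norm_nonneg _) h0).1 h1

/-- The space `Fin d → ℝ` carries the sup norm, so the orthogonal decomposition is made in Euclidean
space and carried back. -/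
lemma exists_add_dotProduct_eq_zero (W : Submodule ℝ (Fin d → ℝ)) (l : Fin d → ℝ) :
    ∃ w ∈ W, ∃ η, (∀ w' ∈ W, η ⬝ᵥ w' = 0) ∧ l = w + η := by
  set e := (WithLp.linearEquiv 2 ℝ (Fin d → ℝ)).symm
  obtain ⟨y, ⟨w, hw, rfl⟩, z, hz, hyz⟩ :=
    (W.map (e : (Fin d → ℝ) →ₗ[ℝ] WithLp 2 (Fin d → ℝ))).exists_add_mem_mem_orthogonal
      (𝕜 := ℝ) (E := EuclideanSpace ℝ (Fin d)) (e l)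
  refine ⟨w, hw, e.symm z, fun w' hw' => ?_, ?_⟩
  · have h1 := (Submodule.mem_orthogonal _ _).1 hz (e w') ⟨w', hw', rfl⟩
    have h2 : inner ℝ (WithLp.toLp 2 w') (WithLp.toLp 2 (e.symm z)) = (e.symm z) ⬝ᵥ w' := by
      rw [EuclideanSpace.inner_toLp_toLp, star_trivial]
    exact h2.symm.trans h1
  · apply e.injective
    rw [map_add, e.apply_symm_apply]
    exact hyz

lemma exists_dotProduct_eq (φ : StrongDual ℝ (Fin d → ℝ)) :
    ∃ l : Fin d → ℝ, ∀ x, φ x = l ⬝ᵥ x := by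
  refine ⟨fun i => φ (Pi.single i 1), fun x => ?_⟩
  conv_lhs => rw [pi_eq_sum_univ' x, map_sum]
  refine Finset.sum_congr rfl fun i _ => ?_
  rw [map_smul, smul_eq_mul, mul_comm]

/-- The Legendre transform with values in the extended reals. -/
noncomputable def legendre (p : (Fin d → ℝ) → ℝ) (x : Fin d → ℝ) : EReal :=
  ⨆ l : Fin d → ℝ, ((l ⬝ᵥ x - p l : ℝ) : EReal)

/-- A convex function with at most one subgradient at each point, and at bounded distance `M` from
the support function of the finite set `V`. -/
structure IsPressure (p : (Fin d → ℝ) → ℝ) (V : Set (Fin d → ℝ)) (M : ℝ) : Prop where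
  finite : V.Finite
  le_add : ∀ x ∈ V, ∀ l, l ⬝ᵥ x ≤ p l + M
  exists_le : ∀ l, ∃ x ∈ V, p l ≤ l ⬝ᵥ x + M
  convexOn : ConvexOn ℝ univ p
  unique : ∀ l x y : Fin d → ℝ, (∀ l', p l + (l' - l) ⬝ᵥ x ≤ p l') →
    (∀ l', p l + (l' - l) ⬝ᵥ y ≤ p l') → x = y

variable {p : (Fin d → ℝ) → ℝ} {V : Set (Fin d → ℝ)} {M : ℝ}

lemma le_legendre (l x : Fin d → ℝ) : ((l ⬝ᵥ x - p l : ℝ) : EReal) ≤ legendre p x :=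
  le_iSup (fun l : Fin d → ℝ => ((l ⬝ᵥ x - p l : ℝ) : EReal)) l

lemma legendre_le_coe_iff {x : Fin d → ℝ} {a : ℝ} :
    legendre p x ≤ a ↔ ∀ l, l ⬝ᵥ x - p l ≤ a := by
  simp only [legendre, iSup_le_iff, EReal.coe_le_coe_iff]

lemma lt_legendre_iff {x : Fin d → ℝ} {a : EReal} :
    a < legendre p x ↔ ∃ l, a < ((l ⬝ᵥ x - p l : ℝ) : EReal) := lt_iSup_iff

lemma neg_le_legendre (x : Fin d → ℝ) : ((-p 0 : ℝ) : EReal) ≤ legendre p x := by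
  simpa using le_legendre (p := p) 0 x

lemma legendre_ne_bot (x : Fin d → ℝ) : legendre p x ≠ ⊥ :=
  ((EReal.bot_lt_coe _).trans_le (neg_le_legendre x)).ne'

lemma continuous_dotProduct_left (l : Fin d → ℝ) : Continuous fun x : Fin d → ℝ => l ⬝ᵥ x := by
  unfold dotProduct
  fun_prop

lemma lowerSemicontinuous_legendre : LowerSemicontinuous (legendre p) := by
  refine lowerSemicontinuous_iSup fun l => Continuous.lowerSemicontinuous ?_
  exact continuous_coe_real_ereal.comp ((continuous_dotProduct_left l).sub continuous_const)

lemma convexEReal_legendre : ConvexEReal (legendre p) := by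
  intro x y a b ha hb hab
  refine iSup_le fun l => ?_
  have h1 : l ⬝ᵥ (a • x + b • y) - p l = a * (l ⬝ᵥ x - p l) + b * (l ⬝ᵥ y - p l) := by
    rw [dotProduct_add, dotProduct_smul, dotProduct_smul, smul_eq_mul, smul_eq_mul]
    linear_combination (p l) * hab
  rw [h1, EReal.coe_add, EReal.coe_mul, EReal.coe_mul]
  exact add_le_add
    (mul_le_mul_of_nonneg_left (le_legendre l x) (EReal.coe_nonneg.2 ha))
    (mul_le_mul_of_nonneg_left (le_legendre l y) (EReal.coe_nonneg.2 hb))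

namespace IsPressure

variable (hp : IsPressure p V M)
include hp

lemma continuous : Continuous p := hp.convexOn.locallyLipschitz.continuous

lemma dotProduct_le {x : Fin d → ℝ} (hx : x ∈ convexHull ℝ V) (l : Fin d → ℝ) :
    l ⬝ᵥ x ≤ p l + M := by
  have hc : Convex ℝ {x : Fin d → ℝ | l ⬝ᵥ x ≤ p l + M} :=
    convex_halfSpace_le (f := fun x => l ⬝ᵥ x)
      ⟨fun x y => dotProduct_add l x y, fun c x => dotProduct_smul c l x⟩ _
  exact convexHull_min (fun x hx => hp.le_add x hx l) hc hx

lemma legendre_le {x : Fin d → ℝ} (hx : x ∈ convexHull ℝ V) : legendre p x ≤ M :=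
  legendre_le_coe_iff.2 fun l => by linarith [hp.dotProduct_le hx l]

/-- Along t l, with l separating x from the polytope, t l·x outgrows the support function, hence p,
by a multiple of t. -/
lemma legendre_eq_top {x : Fin d → ℝ} (hx : x ∉ convexHull ℝ V) : legendre p x = ⊤ := by
  obtain ⟨φ, u, hφ, hu⟩ := geometric_hahn_banach_closed_point (convex_convexHull ℝ V)
    (hp.finite.isClosed_convexHull ℝ) hx
  obtain ⟨l, hl⟩ := exists_dotProduct_eq φ
  rw [hl] at hu
  refine EReal.eq_top_iff_forall_lt _ |>.2 fun a => ?_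
  set δ := l ⬝ᵥ x - u with hδ
  have hδ0 : 0 < δ := sub_pos.2 hu
  set t := (|a| + |M| + 1) / δ with ht
  have ht0 : 0 < t := by positivity
  obtain ⟨v, hv, hpv⟩ := hp.exists_le (t • l)
  have h1 := hφ v (subset_convexHull ℝ V hv)
  rw [hl] at h1
  refine lt_of_lt_of_le (EReal.coe_lt_coe_iff.2 ?_) (le_legendre (t • l) x)
  rw [smul_dotProduct, smul_eq_mul] at hpv ⊢
  have h2 : t * δ = |a| + |M| + 1 := by rw [ht]; field_simp
  have h3 : t * (l ⬝ᵥ v) ≤ t * u := mul_le_mul_of_nonneg_left h1.le ht0.le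
  have h4 : t * δ = t * (l ⬝ᵥ x) - t * u := by rw [hδ]; ring
  have := le_abs_self a
  have := le_abs_self M
  linarith

lemma finiteDomain_legendre : finiteDomain (legendre p) = convexHull ℝ V := by
  ext x
  constructor
  · intro hx
    by_contra hcon
    exact (lt_top_iff_ne_top.1 hx) (hp.legendre_eq_top hcon)
  · exact fun hx => (hp.legendre_le hx).trans_lt (EReal.coe_lt_top M)

lemma coe_toReal {x : Fin d → ℝ} (hx : x ∈ convexHull ℝ V) :
    ((legendre p x).toReal : EReal) = legendre p x :=
  EReal.coe_toReal ((hp.legendre_le hx).trans_lt (EReal.coe_lt_top M)).ne (legendre_ne_bot x)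

lemma convexOn_toReal : ConvexOn ℝ (convexHull ℝ V) fun x => (legendre p x).toReal := by
  refine ⟨convex_convexHull ℝ V, fun x hx y hy a b ha hb hab => ?_⟩
  have h1 := convexEReal_legendre (p := p) x y a b ha hb hab
  rw [← hp.coe_toReal hx, ← hp.coe_toReal hy,
    ← hp.coe_toReal (convex_convexHull ℝ V hx hy ha hb hab)] at h1
  exact_mod_cast h1

lemma uniformContinuousOn_toReal :
    UniformContinuousOn (fun x => (legendre p x).toReal) (convexHull ℝ V) := by
  refine (hp.finite.isCompact_convexHull ℝ).uniformContinuousOn_of_continuous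
    (continuousOn_convexHull_of_lowerSemicontinuousOn hp.finite hp.convexOn_toReal ?_ (M := M) ?_)
  · intro x hx c hc
    have h1 : (c : EReal) < legendre p x := by
      rw [← hp.coe_toReal hx]
      exact_mod_cast hc
    filter_upwards [(lowerSemicontinuous_legendre x _ h1).filter_mono nhdsWithin_le_nhds,
      self_mem_nhdsWithin] with y hy hyV
    rw [← hp.coe_toReal hyV] at hy
    exact_mod_cast hy
  · intro x hx
    have := hp.legendre_le hx
    rw [← hp.coe_toReal hx] at this
    exact_mod_cast this

/-- At a point of the polytope, directions orthogonal to the polytope do not matter. -/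
lemma sub_le_of_orthogonal {x w η : Fin d → ℝ} (hx : x ∈ convexHull ℝ V)
    (hη : ∀ w' ∈ vectorSpan ℝ (convexHull ℝ V), η ⬝ᵥ w' = 0) :
    (w + η) ⬝ᵥ x - p (w + η) ≤ w ⬝ᵥ x - p w := by
  set c := p w + η ⬝ᵥ x - p (w + η) with hc
  -- The point w lies between w - n η and w + η. All of V has the same η-component as x, so p(w - n
  -- η) ≤ p(w) - n η·x + 2 M.
  have key : ∀ n : ℕ, n * c ≤ 2 * M := by
    intro n
    have hn : (0 : ℝ) < n + 1 := by positivity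
    obtain ⟨v, hv, hpv⟩ := hp.exists_le (w - (n : ℝ) • η)
    have h1 := hp.le_add v hv w
    have h2 : η ⬝ᵥ v = η ⬝ᵥ x := by
      have := hη (v - x) (vsub_mem_vectorSpan ℝ (subset_convexHull ℝ V hv) hx)
      rwa [dotProduct_sub, sub_eq_zero] at this
    rw [sub_dotProduct, smul_dotProduct, smul_eq_mul, h2] at hpv
    have hconv := hp.convexOn.2
    have h3 := hconv (mem_univ (w - (n : ℝ) • η)) (mem_univ (w + η))
      (show 0 ≤ 1 / ((n : ℝ) + 1) by positivity) (show 0 ≤ n / ((n : ℝ) + 1) by positivity)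
      (by field_simp; ring)
    have h4 : (1 / ((n : ℝ) + 1)) • (w - (n : ℝ) • η) + (n / ((n : ℝ) + 1)) • (w + η) = w := by
      ext i
      simp
      field_simp
      ring
    rw [h4, smul_eq_mul, smul_eq_mul] at h3
    have h5 : ((n : ℝ) + 1) * p w ≤ p (w - (n : ℝ) • η) + n * p (w + η) := by
      calc ((n : ℝ) + 1) * p w
          ≤ ((n : ℝ) + 1) * (1 / ((n : ℝ) + 1) * p (w - (n : ℝ) • η)
            + n / ((n : ℝ) + 1) * p (w + η)) := mul_le_mul_of_nonneg_left h3 hn.le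
        _ = _ := by field_simp
    rw [hc]
    linarith
  have hc0 : c ≤ 0 := by
    by_contra! hpos
    obtain ⟨n, hn⟩ := exists_nat_gt (2 * M / c)
    rw [div_lt_iff₀ hpos] at hn
    linarith [key n]
  rw [add_dotProduct]
  linarith

/-- The supremum in the Legendre transform is attained on the relative interior. -/
lemma exists_isMax {x : Fin d → ℝ} (hx : x ∈ intrinsicInterior ℝ (convexHull ℝ V)) :
    ∃ l, ∀ l', l' ⬝ᵥ x - p l' ≤ l ⬝ᵥ x - p l := by
  obtain ⟨hxV, δ, hδ, hball⟩ := mem_intrinsicInterior_iff.1 hx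
  set W := vectorSpan ℝ (convexHull ℝ V)
  -- Moving x by δ / 2 along l stays in the polytope, where l· is at most p(l) + M.
  have hcoer : ∀ l ∈ W, l ⬝ᵥ x - p l ≤ M - δ / 2 * ‖l‖ := by
    intro l hl
    rcases eq_or_ne l 0 with rfl | hl0
    · have := hp.dotProduct_le hxV 0
      simp only [zero_dotProduct, norm_zero, mul_zero] at this ⊢
      linarith
    have hn : 0 < ‖l‖ := norm_pos_iff.2 hl0
    have h1 := hball ((δ / 2 / ‖l‖) • l) (W.smul_mem _ hl) (by
      rw [norm_smul, Real.norm_eq_abs, abs_of_pos (by positivity), div_mul_cancel₀ _ hn.ne']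
      linarith)
    have h2 := hp.dotProduct_le h1 l
    rw [dotProduct_add, dotProduct_smul, smul_eq_mul] at h2
    have h3 : δ / 2 * ‖l‖ ≤ δ / 2 / ‖l‖ * (l ⬝ᵥ l) := by
      calc δ / 2 * ‖l‖ = δ / 2 / ‖l‖ * ‖l‖ ^ 2 := by field_simp
        _ ≤ _ := mul_le_mul_of_nonneg_left (sq_norm_le_dotProduct_self l) (by positivity)
    linarith
  -- Beyond this radius the coercive bound drops below -p 0, the value at l = 0.
  set R := |M + p 0| / (δ / 2) with hR
  have hR0 : 0 ≤ R := by positivity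
  have hcomp : IsCompact ((W : Set (Fin d → ℝ)) ∩ Metric.closedBall 0 R) :=
    (isCompact_closedBall 0 R).inter_left W.closed_of_finiteDimensional
  have hcont : Continuous fun l : Fin d → ℝ => l ⬝ᵥ x - p l := by
    refine Continuous.sub ?_ hp.continuous
    simp_rw [dotProduct_comm _ x]
    exact continuous_dotProduct_left x
  obtain ⟨l, ⟨hlW, hlR⟩, hmax⟩ := hcomp.exists_isMaxOn ⟨0, W.zero_mem, by simpa using hR0⟩
    hcont.continuousOn
  have hW : ∀ w ∈ W, w ⬝ᵥ x - p w ≤ l ⬝ᵥ x - p l := by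
    intro w hw
    by_cases hwR : ‖w‖ ≤ R
    · exact hmax ⟨hw, by simpa using hwR⟩
    · have h0 := hmax (a := 0) ⟨W.zero_mem, by simpa using hR0⟩
      simp only [mem_ofPred_eq, zero_dotProduct, zero_sub] at h0
      have h1 := hcoer w hw
      rw [not_le, hR, div_lt_iff₀ (by positivity)] at hwR
      have := le_abs_self (M + p 0)
      linarith
  refine ⟨l, fun l' => ?_⟩
  obtain ⟨w, hw, η, hη, rfl⟩ := exists_add_dotProduct_eq_zero W l'
  exact (hp.sub_le_of_orthogonal hxV hη).trans (hW w hw)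

omit hp in
lemma legendre_eq_of_isMax {l x : Fin d → ℝ} (h : ∀ l', l' ⬝ᵥ x - p l' ≤ l ⬝ᵥ x - p l) :
    legendre p x = ((l ⬝ᵥ x - p l : ℝ) : EReal) :=
  le_antisymm (legendre_le_coe_iff.2 h) (le_legendre l x)

/-- Every slope exposes at most one point. -/
lemma lt_legendre_of_ne {l x y : Fin d → ℝ} (h : ∀ l', l' ⬝ᵥ x - p l' ≤ l ⬝ᵥ x - p l)
    (hxy : y ≠ x) : ((l ⬝ᵥ y - p l : ℝ) : EReal) < legendre p y := by
  by_contra! hcon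
  rw [legendre_le_coe_iff] at hcon
  -- Equality would make both y and x subgradients of p at l.
  refine hxy (hp.unique l y x (fun l' => ?_) fun l' => ?_)
  · have := hcon l'
    rw [sub_dotProduct]
    linarith
  · have := h l'
    rw [sub_dotProduct]
    linarith

lemma strictConvexOn_toReal :
    StrictConvexOn ℝ (intrinsicInterior ℝ (convexHull ℝ V)) fun x => (legendre p x).toReal := by
  refine ⟨convex_intrinsicInterior (convex_convexHull ℝ V), fun x hx y hy hxy a b ha hb hab => ?_⟩
  have hz := convex_intrinsicInterior (convex_convexHull ℝ V) hx hy ha.le hb.le hab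
  -- The affine minorant of slope l touches the transform only at the combination, so it is strictly
  -- below at x.
  obtain ⟨l, hl⟩ := hp.exists_isMax hz
  have hzeq := legendre_eq_of_isMax hl
  have hle : ∀ w ∈ intrinsicInterior ℝ (convexHull ℝ V),
      l ⬝ᵥ w - p l ≤ (legendre p w).toReal := by
    intro w hw
    have := le_legendre (p := p) l w
    rw [← hp.coe_toReal (intrinsicInterior_subset hw)] at this
    exact_mod_cast this
  have hlt : ∀ w ∈ intrinsicInterior ℝ (convexHull ℝ V), w ≠ a • x + b • y →
      l ⬝ᵥ w - p l < (legendre p w).toReal := by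
    intro w hw hne
    have := hp.lt_legendre_of_ne hl hne
    rw [← hp.coe_toReal (intrinsicInterior_subset hw)] at this
    exact_mod_cast this
  have hxne : x ≠ a • x + b • y := by
    intro h
    apply hxy
    have h1 : b • (y - x) = 0 := by
      have h2 : a • x + b • y - x = b • (y - x) := by
        rw [eq_sub_of_add_eq hab]
        module
      rw [← h2, ← h, sub_self]
    exact (sub_eq_zero.1 ((smul_eq_zero.1 h1).resolve_left hb.ne')).symm
  simp only
  rw [hzeq, EReal.toReal_coe, smul_eq_mul, smul_eq_mul, dotProduct_add, dotProduct_smul,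
    dotProduct_smul, smul_eq_mul, smul_eq_mul]
  have h1 := mul_lt_mul_of_pos_left (hlt x hx hxne) ha
  have h2 := mul_le_mul_of_nonneg_left (hle y hy) hb.le
  have h3 : p l = a * p l + b * p l := by rw [← add_mul, hab, one_mul]
  linarith

lemma isGoodExtRateFunction : IsGoodExtRateFunction (legendre p) where
  ne_bot := legendre_ne_bot
  lsc := lowerSemicontinuous_legendre
  isCompact_level a := by
    refine (hp.finite.isCompact_convexHull ℝ).of_isClosed_subset
      (lowerSemicontinuous_legendre.isClosed_preimage (a : EReal)) fun x hx => ?_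
    rw [← hp.finiteDomain_legendre]
    exact lt_of_le_of_lt hx (EReal.coe_lt_top a)

end IsPressure

end Legendre

/-! ### Large deviations from exponential moment bounds. -/

section LargeDeviations

open Set

lemma log_div_le_iff {m : ENNReal} {n : ℕ} (hn : 0 < n) (a : ℝ) :
    ENNReal.log m / (n : EReal) ≤ (a : EReal) ↔ m ≤ ENNReal.ofReal (Real.exp (n * a)) := by
  rw [EReal.div_le_iff_le_mul (by exact_mod_cast hn) (EReal.natCast_ne_top n),
    ← ENNReal.log_le_log_iff, ENNReal.log_ofReal_of_pos (Real.exp_pos _), Real.log_exp]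
  norm_cast

lemma le_log_div_iff {m : ENNReal} {n : ℕ} (hn : 0 < n) (a : ℝ) :
    (a : EReal) ≤ ENNReal.log m / (n : EReal) ↔ ENNReal.ofReal (Real.exp (n * a)) ≤ m := by
  rw [EReal.le_div_iff_mul_le (by exact_mod_cast hn) (EReal.natCast_ne_top n),
    ← ENNReal.log_le_log_iff, ENNReal.log_ofReal_of_pos (Real.exp_pos _), Real.log_exp, mul_comm]
  norm_cast

variable {d : ℕ}

lemma measurable_ofReal_exp (c : ℝ) (l : Fin d → ℝ) :
    Measurable fun y : Fin d → ℝ => ENNReal.ofReal (Real.exp (c * (l ⬝ᵥ y))) := by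
  have := (continuous_dotProduct_left l).measurable
  fun_prop

/-- The exponential Chebyshev bound over a closed set, for measures on a compact set. -/
lemma exists_measure_le {μ : ℕ → Measure (Fin d → ℝ)} {q : (Fin d → ℝ) → ℝ}
    (hmom : ∀ l, ∃ c : ℝ, ∀ n : ℕ, ∫⁻ y, ENNReal.ofReal (Real.exp (n * (l ⬝ᵥ y))) ∂μ n
      ≤ ENNReal.ofReal (c * Real.exp (n * q l)))
    {K : Set (Fin d → ℝ)} (hK : IsCompact K) (hμK : ∀ n, μ n Kᶜ = 0) {F : Set (Fin d → ℝ)}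
    (hF : IsClosed F) {a : ℝ} (ha : ∀ y ∈ F, (a : EReal) < legendre q y) :
    ∃ a' > a, ∃ c : ℝ, ∀ n, μ n F ≤ ENNReal.ofReal (c * Real.exp (n * -a')) := by
  suffices H : ∃ a' > a, ∃ c : ℝ, 0 ≤ c ∧
      ∀ n, μ n (K ∩ F) ≤ ENNReal.ofReal (c * Real.exp (n * -a')) by
    obtain ⟨a', ha', c, -, hc⟩ := H
    refine ⟨a', ha', c, fun n => ?_⟩
    calc μ n F ≤ μ n ((K ∩ F) ∪ Kᶜ) := measure_mono fun x hx => by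
          by_cases hxK : x ∈ K
          · exact Or.inl ⟨hxK, hx⟩
          · exact Or.inr hxK
      _ ≤ μ n (K ∩ F) + μ n Kᶜ := measure_union_le _ _
      _ ≤ _ := by rw [hμK, add_zero]; exact hc n
  -- Finite unions keep the smaller exponent, still above a, so compactness reduces to half-spaces,
  -- handled by Chebyshev.
  refine (hK.inter_right hF).induction_on (p := fun s => ∃ a' > a, ∃ c : ℝ, 0 ≤ c ∧
      ∀ n, μ n s ≤ ENNReal.ofReal (c * Real.exp (n * -a'))) ?_ ?_ ?_ ?_
  · exact ⟨a + 1, by linarith, 0, le_rfl, fun n => by simp⟩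
  · rintro s t hst ⟨a', ha', c, hc, h⟩
    exact ⟨a', ha', c, hc, fun n => (measure_mono hst).trans (h n)⟩
  · rintro s t ⟨a₁, h₁, c₁, hc₁, hs⟩ ⟨a₂, h₂, c₂, hc₂, ht⟩
    refine ⟨min a₁ a₂, lt_min h₁ h₂, c₁ + c₂, add_nonneg hc₁ hc₂, fun n => ?_⟩
    refine (measure_union_le _ _).trans ((add_le_add (hs n) (ht n)).trans ?_)
    rw [← ENNReal.ofReal_add (by positivity) (by positivity), add_mul]
    refine ENNReal.ofReal_le_ofReal ?_
    gcongr
    · exact min_le_left _ _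
    · exact min_le_right _ _
  · intro y hy
    obtain ⟨l, hl⟩ := lt_legendre_iff.1 (ha y hy.2)
    rw [EReal.coe_lt_coe_iff] at hl
    obtain ⟨a', ha', hal⟩ := exists_between hl
    obtain ⟨c, hc⟩ := hmom l
    refine ⟨{z | a' + q l < l ⬝ᵥ z}, mem_nhdsWithin_of_mem_nhds ?_, a', ha', max c 0,
      le_max_right _ _, fun n => ?_⟩
    · exact (isOpen_lt continuous_const (continuous_dotProduct_left l)).mem_nhds
        (by simp only [mem_ofPred_eq]; linarith)
    · have h1 := meas_ge_le_lintegral_div (μ := μ n) (measurable_ofReal_exp n l).aemeasurable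
        (ε := ENNReal.ofReal (Real.exp (n * (a' + q l)))) (by simp [Real.exp_pos])
        ENNReal.ofReal_ne_top
      refine (measure_mono ?_).trans (h1.trans ?_)
      · intro z hz
        simp only [mem_ofPred_eq] at hz ⊢
        gcongr
      · refine (ENNReal.div_le_div_right (hc n) _).trans ?_
        rw [← ENNReal.ofReal_div_of_pos (Real.exp_pos _)]
        refine ENNReal.ofReal_le_ofReal ?_
        rw [mul_div_assoc, ← Real.exp_sub]
        have : (n : ℝ) * q l - n * (a' + q l) = n * -a' := by ring
        rw [this]
        gcongr
        exact le_max_left _ _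

namespace IsPressure

variable {p : (Fin d → ℝ) → ℝ} {V : Set (Fin d → ℝ)} {M : ℝ} (hp : IsPressure p V M)
  {μ : ℕ → Measure (Fin d → ℝ)}
  (hmom : ∀ l, ∃ c : ℝ, ∀ n : ℕ, ∫⁻ y, ENNReal.ofReal (Real.exp (n * (l ⬝ᵥ y))) ∂μ n
    ≤ ENNReal.ofReal (c * Real.exp (n * p l)))
  (hmom' : ∀ l, ∃ c : ℝ, 0 < c ∧ ∀ n : ℕ, ENNReal.ofReal (c * Real.exp (n * p l))
    ≤ ∫⁻ y, ENNReal.ofReal (Real.exp (n * (l ⬝ᵥ y))) ∂μ n)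
  {K : Set (Fin d → ℝ)} (hK : IsCompact K) (hμK : ∀ n, μ n Kᶜ = 0)
include hp hmom hmom' hK hμK

lemma eventually_le_measure {l x : Fin d → ℝ} (hx : ∀ l', l' ⬝ᵥ x - p l' ≤ l ⬝ᵥ x - p l)
    {G : Set (Fin d → ℝ)} (hG : IsOpen G) (hxG : x ∈ G) {r : ℝ} (hr : l ⬝ᵥ x - p l < r) :
    ∀ᶠ n : ℕ in atTop, ENNReal.ofReal (Real.exp (n * -r)) ≤ μ n G := by
  -- On G' the tilting density is at most e^{nb}; since b < r + p l, a bound μ n G < e^{-nr} would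
  -- leave G' too little tilted mass.
  obtain ⟨b, hb, hbr⟩ := exists_between (show l ⬝ᵥ x < r + p l by linarith)
  set G' := G ∩ {y | l ⬝ᵥ y < b} with hG'
  have hG'o : IsOpen G' := hG.inter (isOpen_lt (continuous_dotProduct_left l) continuous_const)
  set ν : ℕ → Measure (Fin d → ℝ) := fun n =>
    (μ n).withDensity fun y => ENNReal.ofReal (Real.exp (n * (l ⬝ᵥ y))) with hν
  have hνK : ∀ n, ν n Kᶜ = 0 := fun n => withDensity_absolutelyContinuous _ _ (hμK n)
  have hνmom : ∀ l', ∃ c : ℝ, ∀ n : ℕ, ∫⁻ y, ENNReal.ofReal (Real.exp (n * (l' ⬝ᵥ y))) ∂ν n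
      ≤ ENNReal.ofReal (c * Real.exp (n * p (l + l'))) := by
    intro l'
    obtain ⟨c, hc⟩ := hmom (l + l')
    refine ⟨c, fun n => le_trans (le_of_eq ?_) (hc n)⟩
    rw [hν, lintegral_withDensity_eq_lintegral_mul _ (measurable_ofReal_exp n l)
      (measurable_ofReal_exp n l')]
    refine lintegral_congr fun y => ?_
    rw [Pi.mul_apply, ← ENNReal.ofReal_mul (Real.exp_pos _).le, ← Real.exp_add, add_dotProduct,
      mul_add]
  -- The transform of p(l + ·) at y is that of p minus l·y. As l exposes x, it exceeds -p l off x,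
  -- so the tilted mass outside G' is negligible against e^{n p(l)}.
  have hexp : ∀ y ∈ G'ᶜ, ((-p l : ℝ) : EReal) < legendre (fun l' => p (l + l')) y := by
    intro y hy
    have hne : y ≠ x := fun h => hy (h ▸ ⟨hxG, hb⟩)
    obtain ⟨m, hm⟩ := lt_legendre_iff.1 (hp.lt_legendre_of_ne hx hne)
    rw [EReal.coe_lt_coe_iff] at hm
    refine lt_legendre_iff.2 ⟨m - l, EReal.coe_lt_coe_iff.2 ?_⟩
    rw [add_sub_cancel, sub_dotProduct]
    linarith
  obtain ⟨a, ha, c, hc⟩ := exists_measure_le hνmom hK hνK hG'o.isClosed_compl hexp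
  obtain ⟨c₀, hc₀, hlow⟩ := hmom' l
  have hlim : Tendsto (fun n : ℕ => Real.exp (n * (b - p l - r)) + |c| * Real.exp (n * (-a - p l)))
      atTop (𝓝 (0 + |c| * 0)) := by
    have hexp0 : ∀ s : ℝ, s < 0 → Tendsto (fun n : ℕ => Real.exp (n * s)) atTop (𝓝 0) :=
      fun s hs => Real.tendsto_exp_atBot.comp
        (tendsto_natCast_atTop_atTop.atTop_mul_const_of_neg hs)
    exact (hexp0 _ (by linarith)).add ((hexp0 _ (by linarith)).const_mul _)
  rw [mul_zero, add_zero] at hlim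
  filter_upwards [hlim.eventually_lt_const hc₀] with n hn
  by_contra! hcon
  have h1 : ν n G' ≤ ENNReal.ofReal (Real.exp (n * -r) * Real.exp (n * b)) := by
    rw [hν, withDensity_apply _ hG'o.measurableSet]
    calc ∫⁻ y in G', ENNReal.ofReal (Real.exp (n * (l ⬝ᵥ y))) ∂μ n
        ≤ ∫⁻ _ in G', ENNReal.ofReal (Real.exp (n * b)) ∂μ n := by
          refine setLIntegral_mono measurable_const fun y hy => ?_
          have := hy.2
          simp only [mem_ofPred_eq] at this
          gcongr
      _ = ENNReal.ofReal (Real.exp (n * b)) * μ n G' := setLIntegral_const _ _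
      _ ≤ _ := by
        rw [mul_comm, ENNReal.ofReal_mul (Real.exp_pos _).le]
        gcongr
        exact (measure_mono inter_subset_left).trans hcon.le
  have h2 : ENNReal.ofReal (c₀ * Real.exp (n * p l)) ≤
      ENNReal.ofReal (Real.exp (n * -r) * Real.exp (n * b) + |c| * Real.exp (n * -a)) := by
    calc ENNReal.ofReal (c₀ * Real.exp (n * p l)) ≤ ν n univ := by
          rw [hν, withDensity_apply _ MeasurableSet.univ, Measure.restrict_univ]
          exact hlow n
      _ ≤ ν n G' + ν n G'ᶜ := by
          rw [← union_compl_self G']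
          exact measure_union_le _ _
      _ ≤ _ := by
        rw [ENNReal.ofReal_add (by positivity) (by positivity)]
        refine add_le_add h1 ((hc n).trans (ENNReal.ofReal_le_ofReal ?_))
        gcongr
        exact le_abs_self c
  rw [ENNReal.ofReal_le_ofReal_iff (by positivity)] at h2
  have h3 : Real.exp (n * -r) * Real.exp (n * b) + |c| * Real.exp (n * -a)
      = (Real.exp (n * (b - p l - r)) + |c| * Real.exp (n * (-a - p l))) * Real.exp (n * p l) := by
    rw [add_mul, mul_assoc, ← Real.exp_add, ← Real.exp_add, ← Real.exp_add]
    congr 2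
    · ring
    · congr 1
      ring_nf
  rw [h3] at h2
  exact (le_of_mul_le_mul_right h2 (Real.exp_pos _)).not_gt hn

/-- The Gärtner–Ellis theorem on a polytope. -/
theorem satisfiesLDP : SatisfiesLDP μ (legendre p) := by
  intro B hB
  refine ⟨?_, liminf_le_limsup, ?_⟩
  · rw [EReal.neg_le]
    refine le_iInf₂ fun x hx => ?_
    set L := liminf (fun n : ℕ => ENNReal.log (μ n B) / (n : EReal)) atTop
    have hri : ∀ w ∈ intrinsicInterior ℝ (convexHull ℝ V), w ∈ interior B →
        ∀ r : ℝ, (legendre p w).toReal < r → -L ≤ r := by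
      intro w hw hwB r hr
      obtain ⟨l, hl⟩ := hp.exists_isMax hw
      rw [legendre_eq_of_isMax hl, EReal.toReal_coe] at hr
      rw [EReal.neg_le, ← EReal.coe_neg]
      refine le_liminf_of_le (by isBoundedDefault) ?_
      filter_upwards [hp.eventually_le_measure hmom hmom' hK hμK hl isOpen_interior hwB hr,
        eventually_gt_atTop 0] with n hn hn0
      exact (le_log_div_iff hn0 _).2 (hn.trans (measure_mono interior_subset))
    by_cases hxV : x ∈ convexHull ℝ V
    swap
    · rw [hp.legendre_eq_top hxV]
      exact le_top
    rw [← hp.coe_toReal hxV]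
    by_contra! hcon
    obtain ⟨r, hr, hrL⟩ := EReal.lt_iff_exists_real_btwn.1 hcon
    rw [EReal.coe_lt_coe_iff] at hr
    -- Points near x on the segment to z lie in the relative interior, and convexity keeps their
    -- rate below a chord value smaller than r.
    obtain ⟨z, hz⟩ := (intrinsicInterior_nonempty (convex_convexHull ℝ V)).2 ⟨x, hxV⟩
    set J := fun y => (legendre p y).toReal
    have hseg : Continuous fun t : ℝ => (1 - t) • x + t • z := by fun_prop
    have e1 : ∀ᶠ t in 𝓝[>] (0 : ℝ), (1 - t) • x + t • z ∈ interior B :=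
      nhdsWithin_le_nhds (hseg.continuousAt.eventually_mem
        (isOpen_interior.mem_nhds (by simpa using hx)))
    have hval : Continuous fun t : ℝ => (1 - t) * J x + t * J z := by fun_prop
    have e2 : ∀ᶠ t in 𝓝[>] (0 : ℝ), (1 - t) * J x + t * J z < r :=
      nhdsWithin_le_nhds (hval.continuousAt.eventually (gt_mem_nhds (by simpa using hr)))
    have e3 : ∀ᶠ t in 𝓝[>] (0 : ℝ), t < 1 := nhdsWithin_le_nhds (gt_mem_nhds one_pos)
    obtain ⟨t, ht1, ht2, ht3, ht0⟩ := (e1.and (e2.and (e3.and self_mem_nhdsWithin))).exists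
    have ht0' : (0 : ℝ) < t := ht0
    have hw := combo_mem_intrinsicInterior (convex_convexHull ℝ V) hxV hz (sub_nonneg.2 ht3.le)
      ht0' (sub_add_cancel 1 t)
    have hJ := hp.convexOn_toReal.2 hxV (intrinsicInterior_subset hz) (sub_nonneg.2 ht3.le)
      ht0'.le (sub_add_cancel 1 t)
    exact (hri _ hw ht1 r (lt_of_le_of_lt hJ ht2)).not_gt hrL
  · rw [EReal.le_neg]
    by_contra! hcon
    obtain ⟨a, haL, ha⟩ := EReal.lt_iff_exists_real_btwn.1 hcon
    obtain ⟨a', ha', c, hc⟩ := exists_measure_le hmom hK hμK isClosed_closure (a := a)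
      fun y hy => ha.trans_le (iInf₂_le y hy)
    have hlim : Tendsto (fun n : ℕ => |c| * Real.exp (n * (a - a'))) atTop (𝓝 (|c| * 0)) :=
      (Real.tendsto_exp_atBot.comp
        (tendsto_natCast_atTop_atTop.atTop_mul_const_of_neg (sub_neg.2 ha'))).const_mul _
    rw [mul_zero] at hlim
    refine haL.not_ge ?_
    rw [EReal.le_neg, ← EReal.coe_neg]
    refine limsup_le_of_le (by isBoundedDefault) ?_
    filter_upwards [hlim.eventually_lt_const one_pos, eventually_gt_atTop 0] with n hn hn0
    rw [log_div_le_iff hn0]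
    refine (measure_mono subset_closure).trans ((hc n).trans (ENNReal.ofReal_le_ofReal ?_))
    have h1 : Real.exp (n * -a') = Real.exp (n * (a - a')) * Real.exp (n * -a) := by
      rw [← Real.exp_add]
      ring_nf
    rw [h1, ← mul_assoc]
    refine mul_le_of_le_one_left (Real.exp_pos _).le (le_trans ?_ hn.le)
    gcongr
    exact le_abs_self c

end IsPressure

end LargeDeviations

/-! ### Exponential moments of the restricted path measures. -/

section Processes

open Matrix

variable {S : Type*} [Fintype S]

/-- Summation over paths of the product of the entries of `B` and a right eigenvector at the end
point. -/
lemma sum_paths_eigenvector {B : Matrix S S ℝ} {C : Set S} (hBC : ∀ i, ∀ j ∉ C, B i j = 0)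
    {r : ℝ} {h : S → ℝ} (hB : ∀ i ∈ C, (B *ᵥ h) i = r * h i) (n : ℕ) {φ : S → ℝ}
    (hφ : ∀ i ∉ C, φ i = 0) :
    ∑ x : Fin (n + 1) → S, φ (x 0) * (∏ i : Fin n, B (x i.castSucc) (x i.succ)) * h (x (Fin.last n))
      = r ^ n * (φ ⬝ᵥ h) := by
  induction n generalizing φ with
  | zero =>
    rw [← (Equiv.funUnique (Fin 1) S).symm.sum_comp]
    simp [dotProduct]
  | succ n ih =>
    -- Summing out the initial state replaces φ by φ B, again supported in C, and φ B · h = φ · B h.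
    rw [← (Fin.consEquiv fun _ => S).sum_comp, Fintype.sum_prod_type, Finset.sum_comm]
    have h1 : ∀ y : Fin (n + 1) → S,
        (∑ a, φ ((Fin.consEquiv fun _ => S) (a, y) 0) *
          (∏ i : Fin (n + 1), B ((Fin.consEquiv fun _ => S) (a, y) i.castSucc)
            ((Fin.consEquiv fun _ => S) (a, y) i.succ)) *
          h ((Fin.consEquiv fun _ => S) (a, y) (Fin.last (n + 1))))
        = (φ ᵥ* B) (y 0) * (∏ i : Fin n, B (y i.castSucc) (y i.succ)) * h (y (Fin.last n)) := by
      intro y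
      rw [vecMul_apply_eq_sum, Finset.sum_mul, Finset.sum_mul]
      refine Finset.sum_congr rfl fun a _ => ?_
      rw [Fin.prod_univ_succ, ← Fin.succ_last]
      simp only [Fin.consEquiv_apply, Fin.cons_zero, Fin.cons_succ, Fin.castSucc_zero,
        Fin.castSucc_succ]
      ring
    rw [Finset.sum_congr rfl fun y _ => h1 y, ih, ← dotProduct_mulVec, pow_succ, mul_assoc]
    · congr 1
      rw [dotProduct, dotProduct, Finset.mul_sum]
      refine Finset.sum_congr rfl fun a _ => ?_
      by_cases ha : a ∈ C
      · rw [hB a ha]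
        ring
      · rw [hφ a ha]
        ring
    · intro j hj
      rw [vecMul_apply_eq_sum]
      exact Finset.sum_eq_zero fun i _ => by rw [hBC i j hj, mul_zero]

variable [MeasurableSpace S] [MeasurableSingletonClass S] {d : ℕ}

lemma lintegral_restrictedLaw (U : Matrix S S ℝ) (C : Finset S) (f : S → Fin d → ℝ) (x₀ : S)
    (n : ℕ) {g : (Fin d → ℝ) → ENNReal} (hg : Measurable g) :
    ∫⁻ y, g y ∂restrictedLaw U C f x₀ n = ∑ x : Fin (n + 1) → S,
      (Measure.dirac x₀ {x 0} * ∏ i : Fin n, ENNReal.ofReal (U (x i.castSucc) (x i.succ))) *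
        {x : Fin (n + 1) → S | ∀ i : Fin n, x i.succ ∈ C}.indicator (fun x => g (average f n x)) x := by
  rw [restrictedLaw, lintegral_map hg (.of_discrete), ← lintegral_indicator (.of_discrete),
    pathMeasure, lintegral_finsetSum_measure]
  refine Finset.sum_congr rfl fun x _ => ?_
  rw [lintegral_smul_measure, lintegral_dirac, smul_eq_mul]

omit [MeasurableSpace S] [MeasurableSingletonClass S] in
lemma average_mem_closedBall (f : S → Fin d → ℝ) (n : ℕ) (x : Fin (n + 1) → S) :
    average f n x ∈ Metric.closedBall (0 : Fin d → ℝ) ‖f‖ := by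
  rw [mem_closedBall_zero_iff, average, norm_smul, norm_inv, Real.norm_natCast]
  rcases n.eq_zero_or_pos with rfl | hn
  · simp
  rw [inv_mul_le_iff₀ (by exact_mod_cast hn)]
  refine (norm_sum_le _ _).trans ((Finset.sum_le_sum fun i _ => norm_le_pi_norm f _).trans ?_)
  simp

omit [MeasurableSpace S] [MeasurableSingletonClass S] in
lemma cube_eq_closedBall (f : S → Fin d → ℝ) : cube f = Metric.closedBall 0 ‖f‖ := by
  ext x
  rw [mem_closedBall_zero_iff, pi_norm_le_iff_of_nonneg (norm_nonneg f)]
  rfl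

lemma restrictedLaw_compl_closedBall (U : Matrix S S ℝ) (C : Finset S) (f : S → Fin d → ℝ)
    (x₀ : S) (n : ℕ) : restrictedLaw U C f x₀ n (Metric.closedBall 0 ‖f‖)ᶜ = 0 := by
  rw [restrictedLaw, Measure.map_apply (.of_discrete) Metric.isClosed_closedBall.measurableSet.compl]
  have hempty : average f n ⁻¹' (Metric.closedBall 0 ‖f‖)ᶜ = ∅ :=
    Set.eq_empty_of_forall_notMem fun x hx => hx (average_mem_closedBall f n x)
  rw [hempty, measure_empty]

/-- Weighting the final state by the eigenvector h makes the path sum exactly e^{np} h(x₀); removing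
the weight costs factors between min h and max h. -/
lemma exists_restrictedLaw_moment_bounds [DecidableEq S] {U : Matrix S S ℝ} (hU : ∀ i j, 0 ≤ U i j)
    {C : Finset S} (hirr : (block U C).IsIrreducible) (f : S → Fin d → ℝ) {x₀ : S} (hx₀ : x₀ ∈ C)
    (l : Fin d → ℝ) :
    ∃ c₁ c₂ : ℝ, 0 < c₁ ∧ ∀ n : ℕ,
      ENNReal.ofReal (c₁ * Real.exp (n * pressure (block U C) (fun j : C => f j) l))
        ≤ ∫⁻ y, ENNReal.ofReal (Real.exp (n * (l ⬝ᵥ y))) ∂restrictedLaw U C f x₀ n ∧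
      ∫⁻ y, ENNReal.ofReal (Real.exp (n * (l ⬝ᵥ y))) ∂restrictedLaw U C f x₀ n
        ≤ ENNReal.ofReal (c₂ * Real.exp (n * pressure (block U C) (fun j : C => f j) l)) := by
  have : Nonempty C := ⟨⟨x₀, hx₀⟩⟩
  have : Nonempty S := ⟨x₀⟩
  obtain ⟨k, hk, he⟩ := exists_pressure_eigenvector (f := fun j : C => f j) hirr l
  set p := pressure (block U C) (fun j : C => f j) l
  -- Off C any positive value would do: the columns of B there vanish and x₀ ∈ C.
  set h : S → ℝ := fun s => if hs : s ∈ C then k ⟨s, hs⟩ else 1 with hh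
  have hpos : ∀ s, 0 < h s := fun s => by
    simp only [hh]
    split_ifs with hs
    · exact hk _
    · exact one_pos
  set B : Matrix S S ℝ := Matrix.of fun i j =>
    if j ∈ C then U i j * Real.exp (l ⬝ᵥ f j) else 0 with hBdef
  have hB0 : ∀ i j, 0 ≤ B i j := fun i j => by
    simp only [hBdef, of_apply]
    split_ifs
    · exact mul_nonneg (hU i j) (Real.exp_pos _).le
    · exact le_rfl
  have hB : ∀ i ∈ (C : Set S), (B *ᵥ h) i = Real.exp p * h i := by
    intro i hi
    have hi' : i ∈ C := hi
    have h1 := congrFun he ⟨i, hi'⟩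
    rw [tilt_mulVec_apply] at h1
    simp only [Pi.smul_apply, smul_eq_mul, block, of_apply] at h1
    rw [mulVec_apply_eq_sum]
    simp only [hBdef, of_apply, ite_mul, zero_mul]
    rw [← Finset.sum_filter, Finset.filter_mem_eq_inter, Finset.univ_inter, ← Finset.sum_coe_sort C]
    simp only [hh, hi', dif_pos, Finset.coe_mem]
    exact h1
  set φ : S → ℝ := Pi.single x₀ 1 with hφdef
  have hφ0 : ∀ s, 0 ≤ φ s := fun s => by
    by_cases hs : s = x₀
    · subst hs
      simp [hφdef]
    · simp [hφdef, hs]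
  have hφ : ∀ i ∉ (C : Set S), φ i = 0 := fun i hi => by
    have : i ≠ x₀ := fun hix => hi (hix ▸ hx₀)
    simp [hφdef, this]
  have hφh : φ ⬝ᵥ h = h x₀ := by simp [hφdef]
  have hsum : ∀ n : ℕ, ∫⁻ y, ENNReal.ofReal (Real.exp (n * (l ⬝ᵥ y))) ∂restrictedLaw U C f x₀ n
      = ENNReal.ofReal (∑ x : Fin (n + 1) → S,
        φ (x 0) * ∏ i : Fin n, B (x i.castSucc) (x i.succ)) := by
    intro n
    rw [lintegral_restrictedLaw U C f x₀ n (measurable_ofReal_exp n l),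
      ENNReal.ofReal_sum_of_nonneg fun x _ =>
        mul_nonneg (hφ0 _) (Finset.prod_nonneg fun i _ => hB0 _ _)]
    refine Finset.sum_congr rfl fun x _ => ?_
    have h0 : Measure.dirac x₀ {x 0} = ENNReal.ofReal (φ (x 0)) := by
      rw [Measure.dirac_apply]
      by_cases hx : x 0 = x₀
      · simp [hφdef, hx]
      · simp [hφdef, hx, Ne.symm hx]
    by_cases hx : ∀ i : Fin n, x i.succ ∈ C
    · rw [Set.indicator_of_mem (by exact hx), h0,
        ← ENNReal.ofReal_prod_of_nonneg fun i _ => hU _ _, mul_assoc,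
        ← ENNReal.ofReal_mul (Finset.prod_nonneg fun i _ => hU _ _),
        ← ENNReal.ofReal_mul (hφ0 _)]
      congr 2
      have h2 : (n : ℝ) * (l ⬝ᵥ average f n x) = ∑ i : Fin n, l ⬝ᵥ f (x i.succ) := by
        rw [average, dotProduct_smul, dotProduct_sum, smul_eq_mul]
        -- At n = 0 both sides vanish, whatever the value of the inverse of 0.
        rcases n.eq_zero_or_pos with rfl | hn
        · simp
        · rw [mul_inv_cancel_left₀ (by positivity)]
      rw [h2, Real.exp_sum, ← Finset.prod_mul_distrib]
      refine Finset.prod_congr rfl fun i _ => ?_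
      simp [hBdef, hx i]
    · rw [Set.indicator_of_notMem (by exact hx), mul_zero]
      push Not at hx
      obtain ⟨i, hi⟩ := hx
      rw [Finset.prod_eq_zero (Finset.mem_univ i) (by simp [hBdef, hi]), mul_zero,
        ENNReal.ofReal_zero]
  obtain ⟨a, ha⟩ := Finite.exists_min h
  obtain ⟨b, hb⟩ := Finite.exists_max h
  refine ⟨h x₀ / h b, h x₀ / h a, div_pos (hpos _) (hpos _), fun n => ?_⟩
  have hpath := sum_paths_eigenvector (fun i j hj => by
    have hj' : j ∉ C := hj
    simp [hBdef, hj']) hB n hφ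
  rw [hφh, ← Real.exp_nat_mul] at hpath
  have hterm : ∀ x : Fin (n + 1) → S, 0 ≤ φ (x 0) * ∏ i : Fin n, B (x i.castSucc) (x i.succ) :=
    fun x => mul_nonneg (hφ0 _) (Finset.prod_nonneg fun i _ => hB0 _ _)
  rw [hsum n]
  constructor
  · refine ENNReal.ofReal_le_ofReal ?_
    rw [div_mul_eq_mul_div, div_le_iff₀ (hpos b), mul_comm (h x₀), ← hpath, Finset.sum_mul]
    exact Finset.sum_le_sum fun x _ => mul_le_mul_of_nonneg_left (hb _) (hterm x)
  · refine ENNReal.ofReal_le_ofReal ?_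
    rw [div_mul_eq_mul_div, le_div_iff₀ (hpos a), mul_comm (h x₀), ← hpath, Finset.sum_mul]
    exact Finset.sum_le_sum fun x _ => mul_le_mul_of_nonneg_left (ha _) (hterm x)

end Processes

/-! ### Assembly of the theorem. -/

lemma exists_isPressure {T : Type*} [Fintype T] [DecidableEq T] [Nonempty T] {d : ℕ}
    {u : Matrix T T ℝ} (hu : u.IsIrreducible) (f : T → Fin d → ℝ) :
    ∃ M, IsPressure (pressure u f) (cycleMeans u f) M := by
  obtain ⟨M, hM, hM'⟩ := exists_pressure_bound (f := f) hu
  exact ⟨M, finite_cycleMeans, hM, hM', convexOn_pressure hu,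
    fun _ _ _ => subgradient_pressure_unique hu⟩

lemma rate_eq_legendre {S : Type*} [DecidableEq S] {d : ℕ} (U : Matrix S S ℝ) (C : Finset S)
    (f : S → Fin d → ℝ) : rate U C f = legendre (pressure (block U C) fun j : C => f j) := rfl

end NonnegProcess

theorem proposition2p1 {S : Type*} [Fintype S] [DecidableEq S] [MeasurableSpace S]
    [MeasurableSingletonClass S] {d : ℕ} (U : Matrix S S ℝ) (hU : ∀ i j, 0 ≤ U i j)
    (C : Finset S) (hC : C.Nonempty) (hirr : (NonnegProcess.block U C).IsIrreducible)
    (f : S → Fin d → ℝ) :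
    ((NonnegProcess.rateDomain U C f).Nonempty ∧
      Convex ℝ (NonnegProcess.rateDomain U C f) ∧
      IsCompact (NonnegProcess.rateDomain U C f) ∧
      NonnegProcess.rateDomain U C f ⊆ NonnegProcess.cube f) ∧
    (NonnegProcess.IsGoodExtRateFunction (NonnegProcess.rate U C f) ∧
      (NonnegProcess.IsSubstochastic (NonnegProcess.block U C) →
        NonnegProcess.IsGoodRateFunction (NonnegProcess.rate U C f))) ∧
    (NonnegProcess.ConvexEReal (NonnegProcess.rate U C f) ∧
      StrictConvexOn ℝ (intrinsicInterior ℝ (NonnegProcess.rateDomain U C f))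
        (fun x => (NonnegProcess.rate U C f x).toReal) ∧
      UniformContinuousOn (fun x => (NonnegProcess.rate U C f x).toReal)
        (NonnegProcess.rateDomain U C f) ∧
      ∃ M : ℝ, ∀ x ∈ NonnegProcess.rateDomain U C f,
        ((-M : ℝ) : EReal) ≤ NonnegProcess.rate U C f x ∧
          NonnegProcess.rate U C f x ≤ (M : EReal)) ∧
    (∀ x₀ ∈ C, NonnegProcess.SatisfiesLDP (NonnegProcess.restrictedLaw U C f x₀)
      (NonnegProcess.rate U C f)) := by
  obtain ⟨c₀, hc₀⟩ := hC
  have : Nonempty C := ⟨⟨c₀, hc₀⟩⟩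
  obtain ⟨M, hp⟩ := NonnegProcess.exists_isPressure hirr fun j : C => f j
  -- From here on Q_C is the polytope spanned by the cycle means.
  rw [NonnegProcess.rateDomain, NonnegProcess.rate_eq_legendre, hp.finiteDomain_legendre]
  refine ⟨⟨?_, convex_convexHull ℝ _, hp.finite.isCompact_convexHull ℝ, ?_⟩,
    ⟨hp.isGoodExtRateFunction, fun hs => ⟨hp.isGoodExtRateFunction, fun x => ?_⟩⟩,
    ⟨NonnegProcess.convexEReal_legendre, hp.strictConvexOn_toReal, hp.uniformContinuousOn_toReal,
      -- The rate is at most M on the polytope and at least -p(0) everywhere.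
      max M (NonnegProcess.pressure (NonnegProcess.block U C) (fun j : C => f j) 0),
      fun x hx => ⟨?_, ?_⟩⟩,
    fun x₀ hx₀ => ?_⟩
  · obtain ⟨x, hx, -⟩ := hp.exists_le 0
    exact ⟨x, subset_convexHull ℝ _ hx⟩
  · rw [NonnegProcess.cube_eq_closedBall]
    refine convexHull_min ?_ (convex_closedBall _ _)
    exact NonnegProcess.cycleMeans_subset (convex_closedBall _ _) fun i =>
      mem_closedBall_zero_iff.2 (norm_le_pi_norm f i)
  · refine le_trans ?_ (NonnegProcess.neg_le_legendre x)
    have := NonnegProcess.pressure_zero_nonpos (f := fun j : C => f j) hirr hs.2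
    exact EReal.coe_nonneg.2 (neg_nonneg.2 this)
  · refine le_trans (EReal.coe_le_coe_iff.2 ?_) (NonnegProcess.neg_le_legendre x)
    exact neg_le_neg (le_max_right _ _)
  · exact (hp.legendre_le hx).trans (EReal.coe_le_coe_iff.2 (le_max_left _ _))
  · have hb := NonnegProcess.exists_restrictedLaw_moment_bounds hU hirr f hx₀
    refine hp.satisfiesLDP (fun l => ?_) (fun l => ?_) (isCompact_closedBall 0 ‖f‖)
      (NonnegProcess.restrictedLaw_compl_closedBall U C f x₀)
    · obtain ⟨c₁, c₂, -, h⟩ := hb l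
      exact ⟨c₂, fun n => (h n).2⟩
    · obtain ⟨c₁, c₂, hc, h⟩ := hb l
      exact ⟨c₁, hc, fun n => (h n).1⟩
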